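/- Let $\mu_{ij}\in\mathbb C\setminus\{0\}$ ($1\le i\le\ell$, $1\le j\le n$), let $D_i(x)=(\mu_{i1}x_1,\dots,\mu_{in}x_n)$ and $D=\{D_1,\dots,D_\ell\}$. Let $F=\{F_1,\dots,F_\ell\}$ be a finite family of pairwise commuting germs of biholomorphisms of $(\mathbb C^n,0)$ such that the linear part of $F_i$ at $0$ is $D_i$. For $Q\in\mathbb N^n$ write $|Q|=q_1+\cdots+q_n$, $\mu_i^Q=\prod_k\mu_{ik}^{q_k}$, and call $(j,Q)$ resonant if $\mu_i^Q=\mu_{ij}$ for all $1\le i\le\ell$. A (formal, resp. holomorphic) completely integrable normal form with respect to $D$ is a family of maps $\hat F_i\colon x_j'=\hat\mu_{ij}(x)x_j$ ($1\le i\le\ell$, $1\le j\le n$), where the $\hat\mu_{ij}$ are formal power series (resp. germs of holomorphic functions) at $0\in\mathbb C^n$ with $\hat\mu_{ij}(0)=\mu_{ij}$ and $\hat\mu_{ij}\circ D_k=\hat\mu_{ij}$ for all $i,j,k$, such that for every $j$ and every $Q\in\mathbb N^n$ with $|Q|\ge2$ one has $\prod_k\hat\mu_{ik}(x)^{q_k}\equiv\hat\mu_{ij}(x)$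 for all $i$ if and only if $(j,Q)$ is resonant. Assume that (1) $F$ is formally completely integrable: there is a formal biholomorphism $\Theta$ of $(\mathbb C^n,0)$ such that $\{\Theta^{-1}\circ F_i\circ\Theta\}_i$ is a formal completely integrable normal form with respect to $D$; (2) $D$ is of Poincaré type: there are constants $d>1$ and $c>0$ such that for every non-resonant $(j,Q)\in\{1,\dots,n\}\times\mathbb N^n$ there is $(i,Q')\in\{1,\dots,\ell\}\times\mathbb N^n$ with $\mu_k^{Q'}=\mu_k^{Q}$ for all $1\le k\le\ell$, $\mu_i^{Q'}\ne\mu_{ij}$, $\max(|\mu_i^{Q'}|,|\mu_i^{Q'}|^{-1})>c^{-1}d^{|Q'|}$, and $Q'-Q\in\mathbb N^n\cup(-\mathbb N^n)$. Call a formal map $\Phi=(\Phi_1,\dots,\Phi_n)$ fixing $0$ and tangent to the identity normalized if the coefficient of $x^Q$ in $\Phi_j$ vanishes for every resonant $(j,Q)$ with $|Q|\ge2$. Then there is exactly one normalized formal map $\Phi$ such that every $\Phi^{-1}\circ F_i\circ\Phi$ commutes with all of $D_1,\dots,D_\ell$. This $\Phi$ is convergent, that is, it is the Taylor expansion of a germ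 of biholomorphism of $(\mathbb C^n,0)$ tangent to the identity, and $\{\Phi^{-1}\circ F_i\circ\Phi\}_i$ is a holomorphic completely integrable normal form $x_j'=\hat\mu_{ij}(x)x_j$ with respect to $D$. In particular $F$ is holomorphically conjugate to a completely integrable normal form each member of which commutes with $D_1,\dots,D_\ell$. -/

import Mathlib

open Filter Topology

/-- The formal power series `p` is the Taylor expansion at `0` of the function `f` of `n` complex
variables: it converges (unconditionally) to `f` at every point near `0`. -/
def HasTaylor {n : ℕ} (f : (Fin n → ℂ) → ℂ) (p : MvPowerSeries (Fin n) ℂ) : Prop :=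
  ∀ᶠ x in 𝓝 (0 : Fin n → ℂ),
    HasSum (fun Q : Fin n →₀ ℕ => MvPowerSeries.coeff Q p * ∏ k, x k ^ Q k) (f x)

/-- Formal maps from `ℂⁿ` to `ℂⁿ`. -/
abbrev FormalMap (n : ℕ) : Type := Fin n → MvPowerSeries (Fin n) ℂ

/-- The formal map whose components are the Taylor expansions at `0` of the components of `F`.
It is meant for maps holomorphic near `0`, whose components have exactly one expansion
(the value is `0` on components that have none). -/
noncomputable def taylorMap {n : ℕ} (F : (Fin n → ℂ) → (Fin n → ℂ)) : FormalMap n :=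
  open Classical in fun j =>
    if h : ∃ p, HasTaylor (fun x => F x j) p then h.choose else 0

namespace FormalMap

variable {n : ℕ}

/-- The composition `Φ ∘ Ψ` of formal maps, meaningful when `Ψ` has no constant term. -/
noncomputable def comp (Φ Ψ : FormalMap n) : FormalMap n :=
  fun j => MvPowerSeries.subst Ψ (Φ j)

/-- The Jacobian matrix at `0`. -/
noncomputable def linearPart (Φ : FormalMap n) : Matrix (Fin n) (Fin n) ℂ :=
  Matrix.of fun j k => MvPowerSeries.coeff (Finsupp.single k 1) (Φ j)

/-- Formal biholomorphisms of `(ℂⁿ, 0)`: no constant term and an invertible linear part. -/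
def IsBiholomorphism (Φ : FormalMap n) : Prop :=
  (∀ j, MvPowerSeries.constantCoeff (Φ j) = 0) ∧ IsUnit Φ.linearPart.det

/-- The diagonal linear map `x ↦ (a₁ x₁, …, aₙ xₙ)`, as a formal map. -/
noncomputable def diag (a : Fin n → ℂ) : FormalMap n :=
  fun j => MvPowerSeries.C (a j) * MvPowerSeries.X j

end FormalMap

section Family

variable {n l : ℕ}

/-- The resonance relation `μ_i ^ Q = μ_{ij}` for all `i`. -/
def IsResonant (μ : Fin l → Fin n → ℂ) (j : Fin n) (Q : Fin n →₀ ℕ) : Prop :=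
  ∀ i, ∏ k, μ i k ^ Q k = μ i j

/-- The family of diagonal linear maps with eigenvalues `μ i 1, …, μ i n` is of Poincaré type. -/
def PoincareType (μ : Fin l → Fin n → ℂ) : Prop :=
  ∃ d c : ℝ, 1 < d ∧ 0 < c ∧ ∀ (j : Fin n) (Q : Fin n →₀ ℕ), ¬ IsResonant μ j Q →
    ∃ (i : Fin l) (Q' : Fin n →₀ ℕ),
      (∀ m, ∏ k, μ m k ^ Q' k = ∏ k, μ m k ^ Q k) ∧
      ∏ k, μ i k ^ Q' k ≠ μ i j ∧
      c⁻¹ * d ^ Q'.degree < max ‖∏ k, μ i k ^ Q' k‖ ‖(∏ k, μ i k ^ Q' k)⁻¹‖ ∧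
      (Q ≤ Q' ∨ Q' ≤ Q)

/-- The formal maps `x_j' = M i j (x) x_j` form a formal completely integrable normal form with
respect to the diagonal linear maps with eigenvalues `μ i 1, …, μ i n`. -/
structure IsFormalIntegrableNF (μ : Fin l → Fin n → ℂ)
    (M : Fin l → Fin n → MvPowerSeries (Fin n) ℂ) : Prop where
  value : ∀ i j, MvPowerSeries.constantCoeff (M i j) = μ i j
  invariant : ∀ i j k, MvPowerSeries.subst (FormalMap.diag (μ k)) (M i j) = M i j
  resonance : ∀ (j : Fin n) (Q : Fin n →₀ ℕ), 2 ≤ Q.degree →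
    ((∀ i, ∏ k, M i k ^ Q k = M i j) ↔ IsResonant μ j Q)

/-- The formal family `f` is formally conjugate to a completely integrable normal form:
`Φ⁻¹ ∘ f i ∘ Φ` is `x_j' = M i j (x) x_j` for some formal biholomorphism `Φ`. -/
def FormallyCompletelyIntegrable (μ : Fin l → Fin n → ℂ) (f : Fin l → FormalMap n) : Prop :=
  ∃ (Φ : FormalMap n) (M : Fin l → Fin n → MvPowerSeries (Fin n) ℂ),
    Φ.IsBiholomorphism ∧ IsFormalIntegrableNF μ M ∧
    ∀ i, (f i).comp Φ = Φ.comp (fun j => M i j * MvPowerSeries.X j)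

/-- The germs of maps `x_j' = M i j (x) x_j` form a holomorphic completely integrable normal form
with respect to the diagonal linear maps with eigenvalues `μ i 1, …, μ i n`. -/
structure IsHolomorphicIntegrableNF (μ : Fin l → Fin n → ℂ)
    (M : Fin l → Fin n → (Fin n → ℂ) → ℂ) : Prop where
  analytic : ∀ i j, AnalyticAt ℂ (M i j) 0
  value : ∀ i j, M i j 0 = μ i j
  invariant : ∀ i j k, (fun x => M i j (μ k * x)) =ᶠ[𝓝 0] M i j
  resonance : ∀ (j : Fin n) (Q : Fin n →₀ ℕ), 2 ≤ Q.degree →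
    ((∀ i, (fun x => ∏ k, M i k x ^ Q k) =ᶠ[𝓝 0] M i j) ↔ IsResonant μ j Q)

/-- The formal map `Φ` is tangent to the identity and has no nonlinear resonant term, that is, it
is normalized with respect to the diagonal linear maps with eigenvalues `μ i 1, …, μ i n`. -/
structure IsNormalized (μ : Fin l → Fin n → ℂ) (Φ : FormalMap n) : Prop where
  constant : ∀ j, MvPowerSeries.constantCoeff (Φ j) = 0
  linear : Φ.linearPart = 1
  nonlinear : ∀ (j : Fin n) (Q : Fin n →₀ ℕ), 2 ≤ Q.degree → IsResonant μ j Q →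
    MvPowerSeries.coeff Q (Φ j) = 0

/-- `Φ` transforms the formal family `f` into a formal normal form `g i = Φ⁻¹ ∘ f i ∘ Φ`, one
in which every member commutes with all the diagonal linear maps. -/
def TransformsToNF (μ : Fin l → Fin n → ℂ) (f : Fin l → FormalMap n) (Φ : FormalMap n) : Prop :=
  ∃ g : Fin l → FormalMap n, (∀ i, (g i).IsBiholomorphism) ∧
    (∀ i, (f i).comp Φ = Φ.comp (g i)) ∧
    ∀ i k, (g i).comp (FormalMap.diag (μ k)) = (FormalMap.diag (μ k)).comp (g i)

end Family

/-! The argument has a formal half and an analytic half.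

Formal half. Give each variable the vector of its eigenvalues as weight. Then `(j, Q)` is resonant
when `x ^ Q` has the weight of `x_j`, and commuting with all `D_k` means preserving weights
(`homog_iff_comp_diag`). Let `Θ` conjugate the family to an integrable normal form with multipliers
`M`, and let `R` be the resonant part of `Θ`. Its inverse `N` preserves weights, so `Ψ = Θ ∘ N` is
normalized, and integrability makes `N` conjugate the normal form to the one with multipliers `M ∘
N` (`exists_isNormalized`). Uniqueness follows degree by degree: a nonresonant coefficient of the
difference of two solutions is multiplied by some `μ_ij - μ_i ^ Q ≠ 0` and must vanish, while a
resonant one vanishes by normalization (`isNormalized_unique`).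

Analytic half. Put `φ = Ψ - id` and let `h_i` be the nonlinear part of `F_i` composed with `Ψ`. The
conjugacy equation reads `h_ij = (M_ij - μ_ij) x_j + (φ_j(M_i x) - μ_ij φ_j)`. The first term
carries exactly the resonant monomials and so is controlled by `h`. The second is nonresonant, and
on each class of monomials with the same `M ^ Q` it is multiplication by `M_i ^ Q - μ_ij`
(`multiplier_mul_restrict`). Integrability allows `Q` to be replaced by the exponent `Q'` of the
Poincaré condition (`IsIntegrableMultiplier.multiPow_eq`), for which this factor is bounded below
uniformly, even after perturbing the eigenvalues into the series `M` (`PoincareType.exists_gap`,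
`le_truncNorm_multiPow_sub_mul`). No small divisors remain.

The bound closes by induction on the truncation degree of a weighted `ℓ¹` norm
(`exists_truncNorm_bound`): if `φ` has norm at most `r` up to degree `m`, then `h` is `O(r²)` up to
degree `m + 1`, because it starts quadratically; hence `M` is close to `μ` up to degree `m`, and `φ`
is `O(r²)`, thus at most `r`, up to degree `m + 1`. Bounded truncated norms give absolute
convergence, and `HasTaylor.comp` turns the formal identities into identities of germs. -/

/-! ### Monomials and induction on multi-indices. -/

section MultiPow

variable {n : ℕ} {W : Type*} [CommMonoid W]

/-- The monomial `y ^ Q` in the entries of the vector `y`. -/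
def multiPow (y : Fin n → W) (Q : Fin n →₀ ℕ) : W := ∏ k, y k ^ Q k

theorem multiPow_zero (y : Fin n → W) : multiPow y 0 = 1 := by simp [multiPow]

theorem multiPow_add (y : Fin n → W) (P Q : Fin n →₀ ℕ) :
    multiPow y (P + Q) = multiPow y P * multiPow y Q := by
  simp [multiPow, pow_add, Finset.prod_mul_distrib]

theorem multiPow_single (y : Fin n → W) (k : Fin n) (m : ℕ) :
    multiPow y (Finsupp.single k m) = y k ^ m := by
  rw [multiPow, Finset.prod_eq_single k]
  · simp
  · intro b _ hb
    simp [Finsupp.single_eq_of_ne hb]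
  · simp

theorem multiPow_single_one (y : Fin n → W) (k : Fin n) :
    multiPow y (Finsupp.single k 1) = y k := by simp [multiPow_single]

theorem multiPow_mul (y z : Fin n → W) (Q : Fin n →₀ ℕ) :
    multiPow (fun k => y k * z k) Q = multiPow y Q * multiPow z Q := by
  simp [multiPow, mul_pow, Finset.prod_mul_distrib]

theorem multiPow_apply {ι : Type*} (y : Fin n → ι → W) (Q : Fin n →₀ ℕ) (i : ι) :
    multiPow y Q i = multiPow (fun k => y k i) Q := by
  simp [multiPow, Finset.prod_apply]

theorem map_multiPow {V : Type*} [CommMonoid V] (φ : W →* V) (y : Fin n → W) (Q : Fin n →₀ ℕ) :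
    φ (multiPow y Q) = multiPow (fun k => φ (y k)) Q := by
  simp [multiPow, map_prod]

theorem exists_eq_single_add {Q : Fin n →₀ ℕ} (hQ : Q ≠ 0) :
    ∃ k P, Q = Finsupp.single k 1 + P := by
  obtain ⟨k, hk⟩ := Finsupp.ne_iff.1 hQ
  refine ⟨k, Q - Finsupp.single k 1, ?_⟩
  rw [add_tsub_cancel_of_le]
  rw [Finsupp.single_le_iff]
  exact Nat.one_le_iff_ne_zero.2 hk

/-- Induction on multi-indices, adding a unit vector at each step. -/
theorem multiIndex_induction {p : (Fin n →₀ ℕ) → Prop} (h0 : p 0)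
    (hs : ∀ k P, p P → p (Finsupp.single k 1 + P)) (Q : Fin n →₀ ℕ) : p Q := by
  induction hd : Q.degree generalizing Q with
  | zero => rwa [(Finsupp.degree_eq_zero_iff Q).1 hd]
  | succ d ih =>
    have hQ : Q ≠ 0 := by rintro rfl; simp at hd
    obtain ⟨k, P, rfl⟩ := exists_eq_single_add hQ
    refine hs k P (ih P ?_)
    simp [map_add, Finsupp.degree_single] at hd
    omega

end MultiPow

/-- The multi-indices of degree at most `m`. -/
noncomputable def multiIndicesLE (n m : ℕ) : Finset (Fin n →₀ ℕ) :=
  (Finsupp.finite_of_degree_le (σ := Fin n) m).toFinset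

theorem mem_multiIndicesLE {n m : ℕ} {Q : Fin n →₀ ℕ} :
    Q ∈ multiIndicesLE n m ↔ Q.degree ≤ m := by simp [multiIndicesLE]

/-! ### Order of vanishing and substitution of formal power series. -/

namespace MvPowerSeries

variable {n : ℕ}

/-- All coefficients of degree less than `m` vanish. -/
def VanishesBelow (m : ℕ) (S : MvPowerSeries (Fin n) ℂ) : Prop :=
  ∀ Q : Fin n →₀ ℕ, Q.degree < m → coeff Q S = 0

namespace VanishesBelow

variable {m m' : ℕ} {S T : MvPowerSeries (Fin n) ℂ}

theorem mono (h : m' ≤ m) (hS : VanishesBelow m S) : VanishesBelow m' S :=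
  fun Q hQ => hS Q (hQ.trans_le h)

theorem zero : VanishesBelow m (0 : MvPowerSeries (Fin n) ℂ) := fun _ _ => by simp

theorem of_zero : VanishesBelow 0 S := fun _ h => by omega

theorem add (hS : VanishesBelow m S) (hT : VanishesBelow m T) : VanishesBelow m (S + T) :=
  fun Q hQ => by simp [hS Q hQ, hT Q hQ]

theorem neg (hS : VanishesBelow m S) : VanishesBelow m (-S) :=
  fun Q hQ => by simp [hS Q hQ]

theorem sub (hS : VanishesBelow m S) (hT : VanishesBelow m T) : VanishesBelow m (S - T) :=
  fun Q hQ => by simp [hS Q hQ, hT Q hQ]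

theorem sum {ι : Type*} {s : Finset ι} {S : ι → MvPowerSeries (Fin n) ℂ}
    (h : ∀ i ∈ s, VanishesBelow m (S i)) : VanishesBelow m (∑ i ∈ s, S i) := fun Q hQ => by
  rw [map_sum]
  exact Finset.sum_eq_zero fun i hi => h i hi Q hQ

theorem mul (hS : VanishesBelow m S) (hT : VanishesBelow m' T) :
    VanishesBelow (m + m') (S * T) := fun Q hQ => by
  rw [coeff_mul]
  refine Finset.sum_eq_zero fun p hp => ?_
  rw [Finset.HasAntidiagonal.mem_antidiagonal] at hp
  have hd : p.1.degree + p.2.degree = Q.degree := by rw [← hp, map_add]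
  by_cases h : p.1.degree < m
  · simp [hS _ h]
  · simp [hT p.2 (by omega)]

theorem mul_left (hT : VanishesBelow m T) : VanishesBelow m (S * T) := by
  simpa using (of_zero (S := S)).mul hT

theorem eq_zero (h : ∀ m, VanishesBelow m S) : S = 0 := by
  ext Q
  simpa using h (Q.degree + 1) Q (Nat.lt_succ_self _)

end VanishesBelow

theorem vanishesBelow_one_iff {S : MvPowerSeries (Fin n) ℂ} :
    VanishesBelow 1 S ↔ constantCoeff S = 0 := by
  constructor
  · intro h
    simpa using h 0 (by simp)
  · intro h Q hQ
    rw [(Finsupp.degree_eq_zero_iff Q).1 (by omega)]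
    simpa using h

theorem vanishesBelow_multiPow {a : Fin n → MvPowerSeries (Fin n) ℂ}
    (ha : ∀ k, constantCoeff (a k) = 0) (Q : Fin n →₀ ℕ) :
    VanishesBelow Q.degree (multiPow a Q) := by
  induction Q using multiIndex_induction with
  | h0 => simpa using VanishesBelow.of_zero
  | hs k P ih =>
    rw [map_add, Finsupp.degree_single, multiPow_add, multiPow_single_one]
    exact (vanishesBelow_one_iff.2 (ha k)).mul ih

theorem vanishesBelow_multiPow_sub {a a' : Fin n → MvPowerSeries (Fin n) ℂ} {m : ℕ}
    (h : ∀ k, VanishesBelow m (a k - a' k)) (Q : Fin n →₀ ℕ) :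
    VanishesBelow m (multiPow a Q - multiPow a' Q) := by
  induction Q using multiIndex_induction with
  | h0 => simpa [multiPow_zero] using VanishesBelow.zero
  | hs k P ih =>
    simp only [multiPow_add, multiPow_single_one]
    have e : a k * multiPow a P - a' k * multiPow a' P =
      multiPow a P * (a k - a' k) + a' k * (multiPow a P - multiPow a' P) := by ring
    rw [e]
    exact (h k).mul_left.add ih.mul_left

/-- In each telescoping term a further factor without constant term accompanies the difference,
which gains one degree. This gain makes formal inversion a contraction and drives the uniqueness
induction. -/
theorem vanishesBelow_multiPow_sub_of_two_le {a a' : Fin n → MvPowerSeries (Fin n) ℂ} {m : ℕ}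
    (ha : ∀ k, constantCoeff (a k) = 0) (ha' : ∀ k, constantCoeff (a' k) = 0)
    (h : ∀ k, VanishesBelow m (a k - a' k)) {Q : Fin n →₀ ℕ} (hQ : 2 ≤ Q.degree) :
    VanishesBelow (m + 1) (multiPow a Q - multiPow a' Q) := by
  have hQ0 : Q ≠ 0 := by rintro rfl; simp at hQ
  obtain ⟨k, P, rfl⟩ := exists_eq_single_add hQ0
  rw [map_add, Finsupp.degree_single] at hQ
  simp only [multiPow_add, multiPow_single_one]
  have e : a k * multiPow a P - a' k * multiPow a' P =
    (a k - a' k) * multiPow a P + (multiPow a P - multiPow a' P) * a' k := by ring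
  rw [e]
  exact ((h k).mul ((vanishesBelow_multiPow ha P).mono (by omega))).add
    ((vanishesBelow_multiPow_sub h P).mul (vanishesBelow_one_iff.2 (ha' k)))

/-- Since `multiPow a Q` vanishes below `Q.degree`, longer exponents do not contribute. The bound
`m` is left free so that one index set serves all `P` of degree at most `m`. -/
theorem coeff_subst_eq_sum {a : Fin n → MvPowerSeries (Fin n) ℂ}
    (ha : ∀ k, constantCoeff (a k) = 0) (f : MvPowerSeries (Fin n) ℂ) {P : Fin n →₀ ℕ} {m : ℕ}
    (hP : P.degree ≤ m) :
    coeff P (subst a f) = ∑ Q ∈ multiIndicesLE n m, coeff Q f * coeff P (multiPow a Q) := by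
  rw [coeff_subst (hasSubst_of_constantCoeff_zero ha)]
  have e : ∀ d : Fin n →₀ ℕ, (d.prod fun s e => a s ^ e) = multiPow a d := fun d =>
    Finsupp.prod_fintype _ _ (by simp)
  simp only [e, smul_eq_mul]
  refine finsum_eq_sum_of_support_subset _ fun Q hQ => ?_
  rw [Finset.mem_coe, mem_multiIndicesLE]
  by_contra hlt
  exact hQ (by simp [vanishesBelow_multiPow ha Q P (by omega)])

theorem vanishesBelow_subst {a : Fin n → MvPowerSeries (Fin n) ℂ}
    (ha : ∀ k, constantCoeff (a k) = 0) {f : MvPowerSeries (Fin n) ℂ} {m : ℕ}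
    (hf : VanishesBelow m f) : VanishesBelow m (subst a f) := fun P hP => by
  rw [coeff_subst_eq_sum ha f le_rfl]
  refine Finset.sum_eq_zero fun Q hQ => ?_
  rw [mem_multiIndicesLE] at hQ
  simp [hf Q (by omega)]

theorem vanishesBelow_subst_sub_subst {a a' : Fin n → MvPowerSeries (Fin n) ℂ} {m : ℕ}
    (ha : ∀ k, constantCoeff (a k) = 0) (ha' : ∀ k, constantCoeff (a' k) = 0)
    (h : ∀ k, VanishesBelow m (a k - a' k)) {f : MvPowerSeries (Fin n) ℂ}
    (hf : VanishesBelow 2 f) : VanishesBelow (m + 1) (subst a f - subst a' f) := fun P hP => by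
  rw [map_sub, coeff_subst_eq_sum ha f le_rfl, coeff_subst_eq_sum ha' f le_rfl,
    ← Finset.sum_sub_distrib]
  refine Finset.sum_eq_zero fun Q _ => ?_
  rw [← mul_sub, ← map_sub]
  by_cases hQ : 2 ≤ Q.degree
  · rw [vanishesBelow_multiPow_sub_of_two_le ha ha' h hQ P hP, mul_zero]
  · rw [hf Q (by omega), zero_mul]

/-- The linear part of a power series. -/
noncomputable def linPart (f : MvPowerSeries (Fin n) ℂ) : MvPowerSeries (Fin n) ℂ :=
  ∑ k, C (coeff (Finsupp.single k 1) f) * X k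

theorem coeff_single_C_mul_X (c : ℂ) (k k' : Fin n) :
    coeff (Finsupp.single k' 1) (C c * X k : MvPowerSeries (Fin n) ℂ) =
      if k' = k then c else 0 := by
  rw [coeff_C_mul, coeff_X]
  simp [Finsupp.single_left_inj]

theorem coeff_C_mul_X_of_degree_ne (c : ℂ) (k : Fin n) {Q : Fin n →₀ ℕ} (hQ : Q.degree ≠ 1) :
    coeff Q (C c * X k : MvPowerSeries (Fin n) ℂ) = 0 := by
  rw [coeff_C_mul, coeff_X, if_neg, mul_zero]
  rintro rfl
  simp [Finsupp.degree_single] at hQ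

theorem exists_eq_single_of_degree_eq_one {Q : Fin n →₀ ℕ} (h : Q.degree = 1) :
    ∃ k, Q = Finsupp.single k 1 := by
  have hQ0 : Q ≠ 0 := by rintro rfl; simp at h
  obtain ⟨k, P, rfl⟩ := exists_eq_single_add hQ0
  rw [map_add, Finsupp.degree_single] at h
  rw [(Finsupp.degree_eq_zero_iff P).1 (by omega)]
  exact ⟨k, by simp⟩

theorem vanishesBelow_two_iff {S : MvPowerSeries (Fin n) ℂ} :
    VanishesBelow 2 S ↔ constantCoeff S = 0 ∧ ∀ k, coeff (Finsupp.single k 1) S = 0 := by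
  constructor
  · exact fun h => ⟨vanishesBelow_one_iff.1 (h.mono (by norm_num)),
      fun k => h _ (by simp [Finsupp.degree_single])⟩
  · rintro ⟨h0, h1⟩ Q hQ
    rcases Nat.lt_or_ge Q.degree 1 with h | h
    · exact vanishesBelow_one_iff.2 h0 Q h
    · obtain ⟨k, rfl⟩ := exists_eq_single_of_degree_eq_one (Q := Q) (by omega)
      exact h1 k

theorem coeff_single_linPart (f : MvPowerSeries (Fin n) ℂ) (k : Fin n) :
    coeff (Finsupp.single k 1) (linPart f) = coeff (Finsupp.single k 1) f := by
  simp only [linPart, map_sum, coeff_single_C_mul_X]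
  simp

theorem vanishesBelow_two_sub_linPart {f : MvPowerSeries (Fin n) ℂ} (hf : constantCoeff f = 0) :
    VanishesBelow 2 (f - linPart f) := by
  rw [vanishesBelow_two_iff]
  refine ⟨?_, fun k => ?_⟩
  · simp [hf, linPart]
  · rw [map_sub, coeff_single_linPart, sub_self]

theorem subst_linPart {a : Fin n → MvPowerSeries (Fin n) ℂ}
    (ha : ∀ k, constantCoeff (a k) = 0) (f : MvPowerSeries (Fin n) ℂ) :
    subst a (linPart f) = ∑ k, C (coeff (Finsupp.single k 1) f) * a k := by
  have hs := hasSubst_of_constantCoeff_zero ha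
  rw [linPart, ← substAlgHom_apply hs, map_sum]
  simp only [map_mul, substAlgHom_apply, subst_C, subst_X hs]

theorem subst_eq_linear_add {a : Fin n → MvPowerSeries (Fin n) ℂ}
    (ha : ∀ k, constantCoeff (a k) = 0) (f : MvPowerSeries (Fin n) ℂ) :
    subst a f = ∑ k, C (coeff (Finsupp.single k 1) f) * a k + subst a (f - linPart f) := by
  rw [← subst_linPart ha, ← subst_add (hasSubst_of_constantCoeff_zero ha), add_sub_cancel]

theorem coeff_single_subst {a : Fin n → MvPowerSeries (Fin n) ℂ}
    (ha : ∀ k, constantCoeff (a k) = 0) {f : MvPowerSeries (Fin n) ℂ}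
    (hf : constantCoeff f = 0) (k : Fin n) :
    coeff (Finsupp.single k 1) (subst a f) =
      ∑ m, coeff (Finsupp.single m 1) f * coeff (Finsupp.single k 1) (a m) := by
  rw [subst_eq_linear_add ha, map_add,
    vanishesBelow_subst ha (vanishesBelow_two_sub_linPart hf) _ (by simp [Finsupp.degree_single]),
    add_zero, map_sum]
  simp only [coeff_C_mul]

theorem constantCoeff_subst_of_zero {a : Fin n → MvPowerSeries (Fin n) ℂ}
    (ha : ∀ k, constantCoeff (a k) = 0) (f : MvPowerSeries (Fin n) ℂ) :
    constantCoeff (subst a f) = constantCoeff f := by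
  have h : f = C (constantCoeff f) + (f - C (constantCoeff f)) := by ring
  have h1 : VanishesBelow 1 (f - C (constantCoeff f)) := by
    rw [vanishesBelow_one_iff]; simp
  conv_lhs => rw [h, subst_add (hasSubst_of_constantCoeff_zero ha), subst_C, map_add,
    vanishesBelow_one_iff.1 (vanishesBelow_subst ha h1)]
  simp

theorem subst_multiPow {a : Fin n → MvPowerSeries (Fin n) ℂ}
    (ha : ∀ k, constantCoeff (a k) = 0) (b : Fin n → MvPowerSeries (Fin n) ℂ) (Q : Fin n →₀ ℕ) :
    subst a (multiPow b Q) = multiPow (fun k => subst a (b k)) Q := by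
  have hs := hasSubst_of_constantCoeff_zero ha
  rw [← substAlgHom_apply hs]
  have := map_multiPow ((substAlgHom (R := ℂ) hs).toRingHom.toMonoidHom) b Q
  simpa using this

/-! ### Weights of monomials and restriction to classes of monomials. -/

section Homog

variable {W : Type*} [CommMonoid W] {y : Fin n → W} {v w : W} {S T : MvPowerSeries (Fin n) ℂ}

/-- All monomials of the series have weight `w`, when the variables have weights `y`. -/
def Homog (y : Fin n → W) (w : W) (S : MvPowerSeries (Fin n) ℂ) : Prop :=
  ∀ Q, coeff Q S ≠ 0 → multiPow y Q = w

theorem Homog.zero : Homog y w (0 : MvPowerSeries (Fin n) ℂ) := fun Q h => by simp at h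

theorem Homog.add (hS : Homog y w S) (hT : Homog y w T) : Homog y w (S + T) := fun Q h => by
  by_cases h1 : coeff Q S = 0
  · exact hT Q (by simpa [h1] using h)
  · exact hS Q h1

theorem Homog.neg (hS : Homog y w S) : Homog y w (-S) := fun Q h => hS Q (by simpa using h)

theorem Homog.sub (hS : Homog y w S) (hT : Homog y w T) : Homog y w (S - T) := by
  rw [sub_eq_add_neg]; exact hS.add hT.neg

theorem Homog.sum {ι : Type*} {s : Finset ι} {S : ι → MvPowerSeries (Fin n) ℂ}
    (h : ∀ i ∈ s, Homog y w (S i)) : Homog y w (∑ i ∈ s, S i) := fun Q hQ => by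
  rw [map_sum] at hQ
  obtain ⟨i, hi, hne⟩ := Finset.exists_ne_zero_of_sum_ne_zero hQ
  exact h i hi Q hne

theorem Homog.mul (hS : Homog y v S) (hT : Homog y w T) : Homog y (v * w) (S * T) := fun Q h => by
  rw [coeff_mul] at h
  obtain ⟨p, hp, hne⟩ := Finset.exists_ne_zero_of_sum_ne_zero h
  rw [Finset.HasAntidiagonal.mem_antidiagonal] at hp
  rw [← hp, multiPow_add, hS _ (left_ne_zero_of_mul hne), hT _ (right_ne_zero_of_mul hne)]

theorem Homog.C (c : ℂ) : Homog y 1 (MvPowerSeries.C c : MvPowerSeries (Fin n) ℂ) := fun Q h => by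
  rw [coeff_C] at h
  rw [(ite_ne_right_iff.1 h).1, multiPow_zero]

theorem Homog.C_mul (c : ℂ) (hS : Homog y w S) : Homog y w (MvPowerSeries.C c * S) := by
  simpa using (Homog.C c).mul hS

theorem Homog.X (k : Fin n) : Homog y (y k) (MvPowerSeries.X k : MvPowerSeries (Fin n) ℂ) :=
  fun Q h => by
    rw [coeff_X] at h
    rw [(ite_ne_right_iff.1 h).1, multiPow_single_one]

theorem Homog.multiPow {a : Fin n → MvPowerSeries (Fin n) ℂ} (ha : ∀ k, Homog y (y k) (a k))
    (Q : Fin n →₀ ℕ) : Homog y (_root_.multiPow y Q) (_root_.multiPow a Q) := by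
  induction Q using multiIndex_induction with
  | h0 => simpa [multiPow_zero] using Homog.C (y := y) (1 : ℂ)
  | hs k P ih => simpa [multiPow_add, multiPow_single_one] using (ha k).mul ih

/-- A map preserving the weights of the variables preserves weights. -/
theorem exists_multiPow_eq_of_coeff_subst_ne_zero {a : Fin n → MvPowerSeries (Fin n) ℂ}
    (ha0 : ∀ k, constantCoeff (a k) = 0) (ha : ∀ k, Homog y (y k) (a k)) {P : Fin n →₀ ℕ}
    (h : coeff P (subst a S) ≠ 0) :
    ∃ Q, coeff Q S ≠ 0 ∧ _root_.multiPow y Q = _root_.multiPow y P := by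
  rw [coeff_subst_eq_sum ha0 S le_rfl] at h
  obtain ⟨Q, -, hne⟩ := Finset.exists_ne_zero_of_sum_ne_zero h
  exact ⟨Q, left_ne_zero_of_mul hne, (Homog.multiPow ha Q P (right_ne_zero_of_mul hne)).symm⟩

theorem Homog.subst {a : Fin n → MvPowerSeries (Fin n) ℂ}
    (ha0 : ∀ k, constantCoeff (a k) = 0) (ha : ∀ k, Homog y (y k) (a k)) (hS : Homog y w S) :
    Homog y w (subst a S) := fun P h => by
  obtain ⟨Q, hQ, hQP⟩ := exists_multiPow_eq_of_coeff_subst_ne_zero ha0 ha h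
  rw [← hQP, hS Q hQ]

end Homog

open Classical in
/-- The part of a power series made of the monomials in a given set. -/
noncomputable def restrict (A : Set (Fin n →₀ ℕ)) (S : MvPowerSeries (Fin n) ℂ) :
    MvPowerSeries (Fin n) ℂ := fun Q => if Q ∈ A then coeff Q S else 0

open Classical in
theorem coeff_restrict (A : Set (Fin n →₀ ℕ)) (S : MvPowerSeries (Fin n) ℂ) (Q : Fin n →₀ ℕ) :
    coeff Q (restrict A S) = if Q ∈ A then coeff Q S else 0 := rfl

theorem coeff_restrict_of_mem {A : Set (Fin n →₀ ℕ)} (S : MvPowerSeries (Fin n) ℂ)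
    {Q : Fin n →₀ ℕ} (h : Q ∈ A) : coeff Q (restrict A S) = coeff Q S := by
  rw [coeff_restrict, if_pos h]

theorem coeff_restrict_of_notMem {A : Set (Fin n →₀ ℕ)} (S : MvPowerSeries (Fin n) ℂ)
    {Q : Fin n →₀ ℕ} (h : Q ∉ A) : coeff Q (restrict A S) = 0 := by
  rw [coeff_restrict, if_neg h]

/-- If the multipliers `M ^ Q` agree for all monomials `x ^ Q` of `S`, then substituting
`M k * x k` for `x k` multiplies `S` by their common value. -/
theorem subst_mul_X {M : Fin n → MvPowerSeries (Fin n) ℂ} {S K : MvPowerSeries (Fin n) ℂ}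
    (h : ∀ Q, coeff Q S ≠ 0 → multiPow M Q = K) :
    subst (fun k => M k * X k) S = K * S := by
  have ha : ∀ k, constantCoeff (M k * X k) = 0 := by simp
  have hX : ∀ Q : Fin n →₀ ℕ, multiPow (fun k => (X k : MvPowerSeries (Fin n) ℂ)) Q =
      monomial Q 1 := by
    intro Q
    induction Q using multiIndex_induction with
    | h0 => simp [multiPow_zero, monomial_zero_one]
    | hs k P ih => rw [multiPow_add, multiPow_single_one, ih, X, monomial_mul_monomial, one_mul]
  ext P
  -- The coefficient at `P` depends on `S` only up to degree `P.degree`, so `S` may be replaced by a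
  -- polynomial.
  set S' : MvPowerSeries (Fin n) ℂ :=
    ∑ Q ∈ multiIndicesLE n P.degree, C (coeff Q S) * monomial Q 1 with hS'
  have hlow : VanishesBelow (P.degree + 1) (S - S') := fun Q hQ => by
    rw [map_sub, hS', map_sum, Finset.sum_eq_single Q]
    · simp
    · intro R _ hR
      rw [coeff_C_mul, coeff_monomial_ne hR.symm, mul_zero]
    · intro hn
      exact absurd (mem_multiIndicesLE.2 (by omega)) hn
  have h1 : coeff P (K * S) = coeff P (K * S') := by
    rw [← sub_eq_zero, ← map_sub, ← mul_sub]
    exact hlow.mul_left P (Nat.lt_succ_self _)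
  rw [coeff_subst_eq_sum ha S le_rfl, h1, hS', Finset.mul_sum, map_sum]
  refine Finset.sum_congr rfl fun Q _ => ?_
  rw [mul_left_comm, coeff_C_mul, multiPow_mul, hX]
  by_cases hQ : coeff Q S = 0
  · simp [hQ]
  · rw [h Q hQ]

end MvPowerSeries

/-! ### Resonance as equality of weights, and multipliers of integrable normal forms. -/

section Resonance

open MvPowerSeries

variable {n l : ℕ}

/-- The weights of the variables under the diagonal linear maps with eigenvalues `μ i k`. -/
def eigenWeight (μ : Fin l → Fin n → ℂ) : Fin n → Fin l → ℂ := fun k i => μ i k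

theorem multiPow_eigenWeight (μ : Fin l → Fin n → ℂ) (Q : Fin n →₀ ℕ) (i : Fin l) :
    multiPow (eigenWeight μ) Q i = multiPow (μ i) Q := by
  rw [multiPow_apply]; rfl

theorem isResonant_iff {μ : Fin l → Fin n → ℂ} {j : Fin n} {Q : Fin n →₀ ℕ} :
    IsResonant μ j Q ↔ multiPow (eigenWeight μ) Q = eigenWeight μ j := by
  rw [funext_iff]
  exact forall_congr' fun i => by rw [multiPow_eigenWeight]; rfl

theorem FormalMap.constantCoeff_diag (a : Fin n → ℂ) (j : Fin n) :
    constantCoeff (FormalMap.diag a j) = 0 := by simp [FormalMap.diag]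

theorem coeff_subst_diag (a : Fin n → ℂ) (S : MvPowerSeries (Fin n) ℂ) (Q : Fin n →₀ ℕ) :
    coeff Q (subst (FormalMap.diag a) S) = multiPow a Q * coeff Q S := by
  have h : FormalMap.diag a = a • (X : Fin n → MvPowerSeries (Fin n) ℂ) := by
    funext j
    simp [FormalMap.diag, smul_eq_C_mul]
  rw [h, ← rescale_eq_subst, coeff_rescale, Finsupp.prod_fintype _ _ (by simp)]
  rfl

/-- Monomials are eigenvectors of composition with a diagonal map, with eigenvalue `μ_k ^ Q`. -/
theorem homog_one_iff {μ : Fin l → Fin n → ℂ} {S : MvPowerSeries (Fin n) ℂ} :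
    Homog (eigenWeight μ) 1 S ↔ ∀ k, subst (FormalMap.diag (μ k)) S = S := by
  constructor
  · intro h k
    ext Q
    rw [coeff_subst_diag, ← multiPow_eigenWeight]
    by_cases hQ : coeff Q S = 0
    · simp [hQ]
    · simp [h Q hQ]
  · intro h Q hQ
    funext k
    have := congrArg (coeff Q) (h k)
    rw [coeff_subst_diag] at this
    rw [multiPow_eigenWeight]
    exact mul_right_cancel₀ hQ (this.trans (one_mul _).symm)

theorem homog_iff_comp_diag {μ : Fin l → Fin n → ℂ} {g : FormalMap n}
    (hg : ∀ j, constantCoeff (g j) = 0) :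
    (∀ j, Homog (eigenWeight μ) (eigenWeight μ j) (g j)) ↔
      ∀ k, g.comp (FormalMap.diag (μ k)) = (FormalMap.diag (μ k)).comp g := by
  have hs := hasSubst_of_constantCoeff_zero hg
  have e : ∀ k j, (FormalMap.diag (μ k)).comp g j = C (μ k j) * g j := fun k j => by
    rw [FormalMap.comp, FormalMap.diag, subst_mul hs, subst_C, subst_X hs]
  constructor
  · intro h k
    funext j
    rw [e]
    ext Q
    rw [FormalMap.comp, coeff_subst_diag, coeff_C_mul, ← multiPow_eigenWeight]
    by_cases hQ : coeff Q (g j) = 0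
    · simp [hQ]
    · rw [h j Q hQ]; rfl
  · intro h j Q hQ
    funext k
    have := congrArg (coeff Q) ((congrFun (h k) j).trans (e k j))
    rw [FormalMap.comp, coeff_subst_diag, coeff_C_mul] at this
    rw [multiPow_eigenWeight]
    exact mul_right_cancel₀ hQ this

/-- Multipliers of a completely integrable normal form, for resonances of any degree. -/
structure IsIntegrableMultiplier (μ : Fin l → Fin n → ℂ)
    (M : Fin l → Fin n → MvPowerSeries (Fin n) ℂ) : Prop where
  value : ∀ i j, constantCoeff (M i j) = μ i j
  homog : ∀ i j, Homog (eigenWeight μ) 1 (M i j)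
  resonance : ∀ (j : Fin n) (Q : Fin n →₀ ℕ), multiPow (eigenWeight μ) Q = eigenWeight μ j →
    ∀ i, multiPow (M i) Q = M i j

/-- The definition only speaks of `|Q| ≥ 2`; lower degrees follow. If `Q = 0` is resonant for `j`,
then so is `2 e_j`, whence `M_j ^ 2 = M_j` and `M_j = 1`. If `e_k` is resonant for `j` and some `P`
of degree at least 2 is too, then `M_k` and `M_j` both equal `M ^ P`. If there is no such `P`, the
multipliers are constant, since a nonconstant monomial `x ^ P` in one of them would make `P + e_j`
resonant. -/
theorem IsFormalIntegrableNF.isIntegrableMultiplier {μ : Fin l → Fin n → ℂ}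
    (hμ : ∀ i j, μ i j ≠ 0) {M : Fin l → Fin n → MvPowerSeries (Fin n) ℂ}
    (h : IsFormalIntegrableNF μ M) : IsIntegrableMultiplier μ M := by
  have hhom : ∀ i j, Homog (eigenWeight μ) 1 (M i j) := fun i j =>
    homog_one_iff.2 fun k => h.invariant i j k
  have hne : ∀ i j, M i j ≠ 0 := fun i j h0 => hμ i j (by rw [← h.value, h0, map_zero])
  have hres : ∀ (j : Fin n) (Q : Fin n →₀ ℕ), 2 ≤ Q.degree →
      multiPow (eigenWeight μ) Q = eigenWeight μ j → ∀ i, multiPow (M i) Q = M i j :=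
    fun j Q hQ hw => (h.resonance j Q hQ).2 (isResonant_iff.2 hw)
  refine ⟨h.value, hhom, fun j Q hw => ?_⟩
  rcases Nat.lt_trichotomy Q.degree 1 with hd | hd | hd
  · obtain rfl := (Finsupp.degree_eq_zero_iff Q).1 (by omega)
    rw [multiPow_zero] at hw
    intro i
    have h2 := hres j (Finsupp.single j 2) (by simp [Finsupp.degree_single])
      (by rw [multiPow_single, ← hw, one_pow]) i
    rw [multiPow_single, sq] at h2
    rw [multiPow_zero]
    exact (mul_left_cancel₀ (hne i j) (h2.trans (mul_one _).symm)).symm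
  · obtain ⟨k, rfl⟩ := exists_eq_single_of_degree_eq_one hd
    intro i
    rw [multiPow_single_one] at hw ⊢
    by_cases hex : ∃ P : Fin n →₀ ℕ, 2 ≤ P.degree ∧ multiPow (eigenWeight μ) P = eigenWeight μ j
    · obtain ⟨P, hP, hPw⟩ := hex
      rw [← hres j P hP hPw i, ← hres k P hP (hPw.trans hw.symm) i]
    · have hconst : ∀ m, M i m = C (μ i m) := fun m => by
        ext P
        rw [coeff_C]
        split_ifs with hP
        · rw [hP, coeff_zero_eq_constantCoeff_apply, h.value]
        · by_contra hne0
          refine hex ⟨P + Finsupp.single j 1, ?_, ?_⟩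
          · rw [map_add, Finsupp.degree_single]
            have := mt (Finsupp.degree_eq_zero_iff P).1 hP
            omega
          · rw [multiPow_add, hhom i m P hne0, one_mul, multiPow_single_one]
      rw [hconst, hconst]
      exact congrArg C (congrFun hw i)
  · exact hres j Q hd hw

/-- The multipliers of a normal form define a map preserving the weights of the variables. -/
theorem IsIntegrableMultiplier.homog_mul_X {μ : Fin l → Fin n → ℂ}
    {M : Fin l → Fin n → MvPowerSeries (Fin n) ℂ} (h : IsIntegrableMultiplier μ M) (i : Fin l)
    (j : Fin n) : Homog (eigenWeight μ) (eigenWeight μ j) (M i j * X j) := by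
  simpa using (h.homog i j).mul (Homog.X j)

theorem IsIntegrableMultiplier.subst {μ : Fin l → Fin n → ℂ}
    {M : Fin l → Fin n → MvPowerSeries (Fin n) ℂ} (h : IsIntegrableMultiplier μ M)
    {N : FormalMap n} (hN0 : ∀ k, constantCoeff (N k) = 0)
    (hN : ∀ k, Homog (eigenWeight μ) (eigenWeight μ k) (N k)) :
    IsIntegrableMultiplier μ fun i j => MvPowerSeries.subst N (M i j) where
  value i j := by rw [constantCoeff_subst_of_zero hN0, h.value]
  homog i j := (h.homog i j).subst hN0 hN
  resonance j Q hw i := by rw [← subst_multiPow hN0, h.resonance j Q hw i]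

end Resonance

/-! ### Formal inversion within the weight-preserving maps. -/

namespace FormalMap

open MvPowerSeries

variable {n : ℕ}

/-- Banach's fixed point theorem for the degree filtration: `T` preserves the maps supported on the
allowed monomials `A` and gains one degree of agreement, so the iterates from `0` stabilize in each
degree. -/
theorem exists_fixedPoint (A : Fin n → Set (Fin n →₀ ℕ)) (T : FormalMap n → FormalMap n)
    (hT : ∀ N, (∀ j Q, coeff Q (N j) ≠ 0 → Q ∈ A j) → ∀ j Q, coeff Q (T N j) ≠ 0 → Q ∈ A j)
    (hc : ∀ N N', (∀ j Q, coeff Q (N j) ≠ 0 → Q ∈ A j) → (∀ j Q, coeff Q (N' j) ≠ 0 → Q ∈ A j) →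
      ∀ m, (∀ j, VanishesBelow m (N j - N' j)) → ∀ j, VanishesBelow (m + 1) (T N j - T N' j)) :
    ∃ N, (∀ j Q, coeff Q (N j) ≠ 0 → Q ∈ A j) ∧ T N = N := by
  set u : ℕ → FormalMap n := fun s => T^[s] (fun _ => 0) with hu
  have hus : ∀ s, u (s + 1) = T (u s) := fun s => Function.iterate_succ_apply' _ _ _
  have hA : ∀ s j Q, coeff Q (u s j) ≠ 0 → Q ∈ A j := by
    intro s
    induction s with
    | zero => intro j Q hQ; simp [hu] at hQ
    | succ s ih => rw [hus]; exact hT _ ih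
  have hstep : ∀ s j, VanishesBelow s (u (s + 1) j - u s j) := by
    intro s
    induction s with
    | zero => exact fun j => VanishesBelow.of_zero
    | succ s ih =>
      intro j
      have := hc _ _ (hA (s + 1)) (hA s) s ih j
      rwa [← hus, ← hus] at this
  have hlate : ∀ s t, s ≤ t → ∀ j, VanishesBelow s (u t j - u s j) := by
    intro s t hst
    induction t, hst using Nat.le_induction with
    | base => intro j; rw [sub_self]; exact VanishesBelow.zero
    | succ t hst ih =>
      intro j
      rw [← sub_add_sub_cancel (u (t + 1) j) (u t j)]
      exact ((hstep t j).mono hst).add (ih j)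
  -- All iterates from the one of index `Q.degree + 1` on have the same coefficient at `Q`.
  set N : FormalMap n := fun j Q => coeff Q (u (Q.degree + 1) j) with hN
  have hcN : ∀ j Q, coeff Q (N j) = coeff Q (u (Q.degree + 1) j) := fun _ _ => rfl
  have hNs : ∀ s j, VanishesBelow s (N j - u s j) := by
    intro s j Q hQ
    have := hlate (Q.degree + 1) s hQ j Q (Nat.lt_succ_self _)
    rw [map_sub, sub_eq_zero] at this ⊢
    rw [hcN, this]
  have hNA : ∀ j Q, coeff Q (N j) ≠ 0 → Q ∈ A j := fun j Q h => hA _ j Q h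
  refine ⟨N, hNA, funext fun j => sub_eq_zero.1 (VanishesBelow.eq_zero fun m => ?_)⟩
  have h1 := (hc N (u m) hNA (hA m) m (hNs m) j).mono (Nat.le_succ m)
  have h2 := (hNs (m + 1) j).mono (Nat.le_succ m)
  rw [hus] at h2
  simpa using h1.sub h2

/-- A weight preserving formal biholomorphism has a weight preserving right inverse. -/
theorem exists_rightInverse {W : Type*} [CommMonoid W] {y : Fin n → W} {R : FormalMap n}
    (hR : R.IsBiholomorphism) (hRy : ∀ j, Homog y (y j) (R j))
    (hinv : ∀ j k, R.linearPart⁻¹ j k ≠ 0 → y k = y j) :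
    ∃ N : FormalMap n, (∀ j, constantCoeff (N j) = 0) ∧ (∀ j, Homog y (y j) (N j)) ∧
      R.comp N = X := by
  set B := R.linearPart⁻¹ with hB
  set h : FormalMap n := fun j => R j - linPart (R j) with hh
  have hh2 : ∀ j, VanishesBelow 2 (h j) := fun j => vanishesBelow_two_sub_linPart (hR.1 j)
  have hhy : ∀ j, Homog y (y j) (h j) := by
    intro j
    refine (hRy j).sub (Homog.sum fun k _ Q hQ => ?_)
    rw [coeff_C_mul, coeff_X] at hQ
    split_ifs at hQ with hk
    · rw [hk]; exact hRy j _ (left_ne_zero_of_mul hQ)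
    · simp at hQ
  set A : Fin n → Set (Fin n →₀ ℕ) := fun j => {Q | Q ≠ 0 ∧ multiPow y Q = y j} with hA
  have hAiff : ∀ N : FormalMap n, (∀ j Q, coeff Q (N j) ≠ 0 → Q ∈ A j) ↔
      (∀ j, constantCoeff (N j) = 0) ∧ ∀ j, Homog y (y j) (N j) := by
    intro N
    constructor
    · intro hN
      refine ⟨fun j => ?_, fun j Q hQ => (hN j Q hQ).2⟩
      by_contra h0
      exact (hN j 0 (by simpa using h0)).1 rfl
    · rintro ⟨h0, h1⟩ j Q hQ
      refine ⟨?_, h1 j Q hQ⟩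
      rintro rfl
      exact hQ (by simpa using h0 j)
  -- With `R = linear part + h` and `B` the inverse matrix, `R ∘ N = id` is the fixed point equation
  -- `N = B (X - h ∘ N)`. It contracts because `h` starts in degree 2.
  set T : FormalMap n → FormalMap n := fun N j => ∑ k, C (B j k) * (X k - subst N (h k)) with hTdef
  have hpres : ∀ N, (∀ j Q, coeff Q (N j) ≠ 0 → Q ∈ A j) →
      ∀ j Q, coeff Q (T N j) ≠ 0 → Q ∈ A j := by
    intro N hN
    rw [hAiff] at hN ⊢
    have hk0 : ∀ k, constantCoeff (subst N (h k)) = 0 := fun k => by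
      rw [constantCoeff_subst_of_zero hN.1]
      exact vanishesBelow_one_iff.1 ((hh2 k).mono one_le_two)
    refine ⟨fun j => ?_, fun j => Homog.sum fun k _ => ?_⟩
    · simp [hTdef, hk0]
    · by_cases hjk : B j k = 0
      · simpa [hjk] using Homog.zero
      · rw [← hinv j k hjk]
        exact ((Homog.X k).sub ((hhy k).subst hN.1 hN.2)).C_mul _
  have hcontr : ∀ N N', (∀ j Q, coeff Q (N j) ≠ 0 → Q ∈ A j) →
      (∀ j Q, coeff Q (N' j) ≠ 0 → Q ∈ A j) → ∀ m, (∀ j, VanishesBelow m (N j - N' j)) →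
      ∀ j, VanishesBelow (m + 1) (T N j - T N' j) := by
    intro N N' hN hN' m hm j
    rw [hAiff] at hN hN'
    simp only [hTdef]
    rw [← Finset.sum_sub_distrib]
    refine VanishesBelow.sum fun k _ => ?_
    rw [← mul_sub, sub_sub_sub_cancel_left]
    refine (vanishesBelow_subst_sub_subst hN'.1 hN.1 (fun k => ?_) (hh2 k)).mul_left
    rw [← neg_sub]
    exact (hm k).neg
  obtain ⟨N, hN, hTN⟩ := exists_fixedPoint A T hpres hcontr
  rw [hAiff] at hN
  refine ⟨N, hN.1, hN.2, funext fun j => ?_⟩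
  have hAB : R.linearPart * B = 1 := Matrix.mul_nonsing_inv _ hR.2
  have hsum : ∑ m, C (coeff (Finsupp.single m 1) (R j)) * N m = X j - subst N (h j) := by
    conv_lhs => rw [← hTN]
    simp only [hTdef, Finset.mul_sum, ← mul_assoc, ← map_mul]
    rw [Finset.sum_comm]
    simp only [← Finset.sum_mul, ← map_sum]
    have : ∀ k, ∑ m, coeff (Finsupp.single m 1) (R j) * B m k =
        (1 : Matrix (Fin n) (Fin n) ℂ) j k := fun k => by
      rw [← hAB, Matrix.mul_apply]; rfl
    simp only [this, Matrix.one_apply]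
    rw [Finset.sum_eq_single j]
    · simp
    · intro k _ hk; simp [hk.symm]
    · simp
  rw [comp, subst_eq_linear_add hN.1, hsum]
  simp [hh]
end FormalMap

/-! ### Existence of a normalized transformation. -/

section Normalization

open MvPowerSeries

variable {n l : ℕ}

theorem FormalMap.constantCoeff_comp {Φ Ψ : FormalMap n} (hΨ : ∀ k, constantCoeff (Ψ k) = 0)
    (hΦ : ∀ k, constantCoeff (Φ k) = 0) (j : Fin n) : constantCoeff (Φ.comp Ψ j) = 0 := by
  rw [FormalMap.comp, constantCoeff_subst_of_zero hΨ, hΦ]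

theorem FormalMap.comp_assoc {Φ Ψ Ξ : FormalMap n} (hΨ : ∀ k, constantCoeff (Ψ k) = 0)
    (hΞ : ∀ k, constantCoeff (Ξ k) = 0) : (Φ.comp Ψ).comp Ξ = Φ.comp (Ψ.comp Ξ) := by
  funext j
  exact subst_comp_subst_apply (hasSubst_of_constantCoeff_zero hΨ)
    (hasSubst_of_constantCoeff_zero hΞ) (Φ j)

theorem FormalMap.linearPart_comp {Φ Ψ : FormalMap n} (hΨ : ∀ k, constantCoeff (Ψ k) = 0)
    (hΦ : ∀ k, constantCoeff (Φ k) = 0) :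
    (Φ.comp Ψ).linearPart = Φ.linearPart * Ψ.linearPart := by
  ext j k
  rw [Matrix.mul_apply]
  exact coeff_single_subst hΨ (hΦ j) k

/-- The linear part of a conjugacy between two maps with the same diagonal linear parts
commutes with the latter. -/
theorem commute_diagonal_linearPart {μ : Fin l → Fin n → ℂ} {f g : Fin l → FormalMap n}
    (hf0 : ∀ i j, constantCoeff (f i j) = 0)
    (hf : ∀ i, (f i).linearPart = Matrix.diagonal (μ i))
    (hg0 : ∀ i j, constantCoeff (g i j) = 0)
    (hg : ∀ i, (g i).linearPart = Matrix.diagonal (μ i))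
    {Θ : FormalMap n} (hΘ0 : ∀ j, constantCoeff (Θ j) = 0)
    (h : ∀ i, (f i).comp Θ = Θ.comp (g i)) (i : Fin l) :
    Commute (Matrix.diagonal (μ i)) Θ.linearPart := by
  have := congrArg FormalMap.linearPart (h i)
  rwa [FormalMap.linearPart_comp hΘ0 (hf0 i), FormalMap.linearPart_comp (hg0 i) hΘ0, hf, hg] at this

theorem eigenWeight_eq_of_commute {μ : Fin l → Fin n → ℂ} {B : Matrix (Fin n) (Fin n) ℂ}
    (h : ∀ i, Commute (Matrix.diagonal (μ i)) B) {j k : Fin n} (hjk : B j k ≠ 0) :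
    eigenWeight μ k = eigenWeight μ j := by
  funext i
  have := congrFun (congrFun (h i).eq j) k
  rw [Matrix.diagonal_mul, Matrix.mul_diagonal, mul_comm] at this
  exact (mul_left_cancel₀ hjk this).symm

theorem linearPart_mul_X (M : Fin n → MvPowerSeries (Fin n) ℂ) :
    FormalMap.linearPart (fun j => M j * X j) =
      Matrix.diagonal fun j => constantCoeff (M j) := by
  ext j k
  rw [FormalMap.linearPart, Matrix.of_apply, Matrix.diagonal_apply]
  have h : M j = C (constantCoeff (M j)) + (M j - C (constantCoeff (M j))) := by ring
  have h1 : VanishesBelow (1 + 1) ((M j - C (constantCoeff (M j))) * X j) :=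
    VanishesBelow.mul (vanishesBelow_one_iff.2 (by simp)) (vanishesBelow_one_iff.2 (by simp))
  rw [h, add_mul, map_add, h1 _ (by simp [Finsupp.degree_single]), add_zero, coeff_single_C_mul_X]
  simp [eq_comm]

/-- A formally completely integrable family has a normalized transformation to a completely
integrable normal form. -/
theorem exists_isNormalized {μ : Fin l → Fin n → ℂ} (hμ : ∀ i j, μ i j ≠ 0)
    {f : Fin l → FormalMap n} (hf0 : ∀ i j, constantCoeff (f i j) = 0)
    (hf : ∀ i, (f i).linearPart = Matrix.diagonal (μ i))
    (hint : FormallyCompletelyIntegrable μ f) :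
    ∃ (Ψ : FormalMap n) (M : Fin l → Fin n → MvPowerSeries (Fin n) ℂ),
      IsNormalized μ Ψ ∧ IsIntegrableMultiplier μ M ∧
      ∀ i, (f i).comp Ψ = Ψ.comp (fun j => M i j * X j) := by
  obtain ⟨Θ, M, hΘ, hM, hconj⟩ := hint
  replace hM := hM.isIntegrableMultiplier hμ
  have hMX0 : ∀ i j, constantCoeff (M i j * X j) = 0 := by simp
  have hcomm := commute_diagonal_linearPart hf0 hf hMX0
    (fun i => by rw [linearPart_mul_X]; simp only [hM.value]) hΘ.1 hconj
  -- `R` is the resonant part of `Θ`. It keeps the whole linear part, which commutes with the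
  -- diagonal matrices and hence only mixes variables of equal weight.
  set R : FormalMap n := fun j => restrict {Q | multiPow (eigenWeight μ) Q = eigenWeight μ j} (Θ j)
    with hR
  have hRy : ∀ j, Homog (eigenWeight μ) (eigenWeight μ j) (R j) := fun j Q hQ => by
    by_contra hn
    exact hQ (coeff_restrict_of_notMem _ hn)
  have hlin : R.linearPart = Θ.linearPart := by
    ext j k
    by_cases hw : multiPow (eigenWeight μ) (Finsupp.single k 1) = eigenWeight μ j
    · exact coeff_restrict_of_mem _ hw
    · refine (coeff_restrict_of_notMem _ hw).trans ?_
      by_contra hne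
      exact hw (by rw [multiPow_single_one,
        eigenWeight_eq_of_commute hcomm (j := j) (k := k) (Ne.symm hne)])
  have hR0 : ∀ j, constantCoeff (R j) = 0 := fun j => by
    rw [← coeff_zero_eq_constantCoeff_apply, hR, coeff_restrict]
    have := hΘ.1 j
    rw [← coeff_zero_eq_constantCoeff_apply] at this
    simp [this]
  have hRb : R.IsBiholomorphism := ⟨hR0, by rw [hlin]; exact hΘ.2⟩
  obtain ⟨N, hN0, hN, hRN⟩ := FormalMap.exists_rightInverse hRb hRy fun j k hjk => by
    refine eigenWeight_eq_of_commute (fun i => ?_) hjk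
    rw [hlin]
    have h1 := Matrix.mul_nonsing_inv _ hΘ.2
    have h2 := Matrix.nonsing_inv_mul _ hΘ.2
    exact Commute.units_inv_right (u := Units.mk _ _ h1 h2) (hcomm i)
  have hNs := hasSubst_of_constantCoeff_zero hN0
  have hM' := hM.subst hN0 hN
  -- As `R ∘ N = id`, the nonlinear terms of `Θ ∘ N` come from the nonresonant part of `Θ`, and they
  -- remain nonresonant because `N` preserves weights.
  have hd : ∀ j, Θ.comp N j = X j + subst N (Θ j - R j) := fun j => by
    have := congrFun hRN j
    rw [FormalMap.comp] at this ⊢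
    rw [subst_sub hNs, this, add_sub_cancel]
  refine ⟨Θ.comp N, _, ⟨FormalMap.constantCoeff_comp hN0 hΘ.1, ?_, fun j P hP hres => ?_⟩, hM',
    fun i => ?_⟩
  · rw [FormalMap.linearPart_comp hN0 hΘ.1, ← hlin, ← FormalMap.linearPart_comp hN0 hR0, hRN]
    ext j k
    rw [FormalMap.linearPart, Matrix.of_apply, coeff_X, Matrix.one_apply]
    simp [Finsupp.single_left_inj, eq_comm]
  · rw [hd, map_add, coeff_X, if_neg (by rintro rfl; simp [Finsupp.degree_single] at hP), zero_add]
    by_contra hne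
    obtain ⟨Q, hQ, hQP⟩ := exists_multiPow_eq_of_coeff_subst_ne_zero hN0 hN hne
    rw [map_sub, hR, coeff_restrict_of_mem _ (hQP.trans (isResonant_iff.1 hres)), sub_self] at hQ
    exact hQ rfl
  -- Every monomial `x ^ Q` of `N j` is resonant for `j`, so by integrability its multiplier is that
  -- of `x_j`. Hence `N` intertwines the two normal forms.
  · have h1 : FormalMap.comp (fun j => M i j * X j) N =
        N.comp (fun j => subst N (M i j) * X j) := by
      funext j
      rw [FormalMap.comp, FormalMap.comp, subst_mul hNs, subst_X hNs]
      exact (subst_mul_X fun Q hQ => hM'.resonance j Q (hN j Q hQ) i).symm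
    rw [← FormalMap.comp_assoc hΘ.1 hN0, hconj, FormalMap.comp_assoc (hMX0 i) hN0, h1,
      FormalMap.comp_assoc hN0 (by simp)]

end Normalization

/-! ### Uniqueness of the normalized transformation. -/

section Uniqueness

open MvPowerSeries

variable {n l : ℕ}

/-- On the lowest-degree part of `S`, only the linear part of the substituted map acts. It serves to
replace a normal form by its diagonal linear part. -/
theorem MvPowerSeries.vanishesBelow_subst_sub_of_sub_vanishesBelow_two
    {a a' : Fin n → MvPowerSeries (Fin n) ℂ}
    (ha : ∀ k, constantCoeff (a k) = 0) (ha' : ∀ k, constantCoeff (a' k) = 0)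
    (h : ∀ k, VanishesBelow 2 (a k - a' k)) {S : MvPowerSeries (Fin n) ℂ} {m : ℕ}
    (hS : VanishesBelow m S) : VanishesBelow (m + 1) (subst a S - subst a' S) := by
  have hpow : ∀ Q : Fin n →₀ ℕ, VanishesBelow (Q.degree + 1) (multiPow a Q - multiPow a' Q) := by
    intro Q
    induction Q using multiIndex_induction with
    | h0 => simpa [multiPow_zero] using VanishesBelow.zero
    | hs k P ih =>
      simp only [multiPow_add, multiPow_single_one, map_add, Finsupp.degree_single]
      have e : a k * multiPow a P - a' k * multiPow a' P =
        (a k - a' k) * multiPow a P + a' k * (multiPow a P - multiPow a' P) := by ring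
      rw [e]
      exact (((h k).mul (vanishesBelow_multiPow ha P)).mono (by omega)).add
        (((vanishesBelow_one_iff.2 (ha' k)).mul ih).mono (by omega))
  intro P hP
  rw [map_sub, coeff_subst_eq_sum ha S le_rfl, coeff_subst_eq_sum ha' S le_rfl,
    ← Finset.sum_sub_distrib]
  refine Finset.sum_eq_zero fun Q _ => ?_
  rw [← mul_sub, ← map_sub]
  by_cases hQ : m ≤ Q.degree
  · rw [hpow Q P (by omega), mul_zero]
  · rw [hS Q (by omega), zero_mul]

theorem MvPowerSeries.vanishesBelow_two_sub_of_linear_eq {S T : MvPowerSeries (Fin n) ℂ}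
    (hS : constantCoeff S = 0) (hT : constantCoeff T = 0)
    (h : ∀ k, coeff (Finsupp.single k 1) S = coeff (Finsupp.single k 1) T) :
    VanishesBelow 2 (S - T) := by
  rw [vanishesBelow_two_iff]
  refine ⟨by simp [hS, hT], fun k => ?_⟩
  rw [map_sub, h, sub_self]

theorem FormalMap.sum_linearPart_diagonal {g : FormalMap n} {a : Fin n → ℂ}
    (hg : g.linearPart = Matrix.diagonal a) (b : Fin n → MvPowerSeries (Fin n) ℂ) (j : Fin n) :
    ∑ k, C (coeff (Finsupp.single k 1) (g j)) * b k = C (a j) * b j := by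
  have : ∀ k, coeff (Finsupp.single k 1) (g j) = Matrix.diagonal a j k := fun k => by
    rw [← hg]; rfl
  simp only [this]
  rw [Finset.sum_eq_single j]
  · simp
  · intro k _ hk; simp [Matrix.diagonal_apply_ne _ hk.symm]
  · simp

/-- Transformations and normal forms are compared together, by induction on the degree up to which
both pairs agree. -/
theorem isNormalized_unique {μ : Fin l → Fin n → ℂ} {f g g' : Fin l → FormalMap n}
    {Ψ Ψ' : FormalMap n} (hf0 : ∀ i j, constantCoeff (f i j) = 0)
    (hf : ∀ i, (f i).linearPart = Matrix.diagonal (μ i))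
    (hΨ : IsNormalized μ Ψ) (hΨ' : IsNormalized μ Ψ')
    (hg0 : ∀ i j, constantCoeff (g i j) = 0) (hg0' : ∀ i j, constantCoeff (g' i j) = 0)
    (h : ∀ i, (f i).comp Ψ = Ψ.comp (g i)) (h' : ∀ i, (f i).comp Ψ' = Ψ'.comp (g' i))
    (hg : ∀ i j, Homog (eigenWeight μ) (eigenWeight μ j) (g i j))
    (hg' : ∀ i j, Homog (eigenWeight μ) (eigenWeight μ j) (g' i j)) : Ψ = Ψ' := by
  have hlin : ∀ {Ψ : FormalMap n} {g : Fin l → FormalMap n}, IsNormalized μ Ψ →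
      (∀ i j, constantCoeff (g i j) = 0) → (∀ i, (f i).comp Ψ = Ψ.comp (g i)) →
      ∀ i, (g i).linearPart = Matrix.diagonal (μ i) := by
    intro Ψ g hΨ hg0 h i
    have := congrArg FormalMap.linearPart (h i)
    rw [FormalMap.linearPart_comp hΨ.constant (hf0 i),
      FormalMap.linearPart_comp (hg0 i) hΨ.constant, hΨ.linear, hf, mul_one, one_mul] at this
    exact this.symm
  have hone : ∀ {Ψ : FormalMap n}, IsNormalized μ Ψ → Ψ.linearPart = Matrix.diagonal fun _ => 1 :=
    fun hΨ => by rw [hΨ.linear, Matrix.diagonal_one]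
  have hlow : ∀ j, VanishesBelow 2 (Ψ j - Ψ' j) := fun j =>
    vanishesBelow_two_sub_of_linear_eq (hΨ.constant j) (hΨ'.constant j) fun k =>
      congrFun (congrFun (hΨ.linear.trans hΨ'.linear.symm) j) k
  have hdiag : ∀ i k, VanishesBelow 2 (g i k - FormalMap.diag (μ i) k) := fun i k =>
    vanishesBelow_two_sub_of_linear_eq (hg0 i k) (FormalMap.constantCoeff_diag _ _) fun m => by
      rw [FormalMap.diag, coeff_single_C_mul_X]
      refine (congrFun (congrFun (hlin hΨ hg0 h i) k) m).trans ?_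
      simp [Matrix.diagonal_apply, eq_comm]
  have key : ∀ m, (∀ j, VanishesBelow m (Ψ j - Ψ' j)) ∧ ∀ i j, VanishesBelow m (g i j - g' i j) := by
    intro m
    induction m with
    | zero => exact ⟨fun _ => VanishesBelow.of_zero, fun _ _ => VanishesBelow.of_zero⟩
    | succ m ih =>
      -- The degree `m` part of the difference of the two conjugacy equations. The nonlinear parts
      -- contribute nothing new in this degree (`e1`, `e2`), and `g i` acts on `Ψ j - Ψ' j` through
      -- its linear part alone (`e3`).
      have hrel : ∀ i j Q, Q.degree = m → μ i j * coeff Q (Ψ j - Ψ' j) =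
          coeff Q (g i j - g' i j) + multiPow (μ i) Q * coeff Q (Ψ j - Ψ' j) := by
        intro i j Q hQ
        have e1 := vanishesBelow_subst_sub_subst hΨ.constant hΨ'.constant ih.1
          (vanishesBelow_two_sub_linPart (hf0 i j)) Q (by omega)
        have e2 := vanishesBelow_subst_sub_subst (hg0 i) (hg0' i) (ih.2 i)
          (vanishesBelow_two_sub_linPart (hΨ'.constant j)) Q (by omega)
        have e3 := vanishesBelow_subst_sub_of_sub_vanishesBelow_two (hg0 i)
          (FormalMap.constantCoeff_diag (μ i)) (hdiag i) (ih.1 j) Q (by omega)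
        have hX : linPart (Ψ j) = linPart (Ψ' j) := by
          rw [linPart, linPart, FormalMap.sum_linearPart_diagonal (hone hΨ),
            FormalMap.sum_linearPart_diagonal (hone hΨ')]
        have e4 : subst (g i) (Ψ j - linPart (Ψ j)) = subst (g i) (Ψ' j - linPart (Ψ' j)) +
            subst (g i) (Ψ j - Ψ' j) := by
          rw [← subst_add (hasSubst_of_constantCoeff_zero (hg0 i)), hX]
          congr 1
          ring
        have c := congrArg (coeff Q) (congrFun (h i) j)
        have c' := congrArg (coeff Q) (congrFun (h' i) j)
        rw [FormalMap.comp, FormalMap.comp, subst_eq_linear_add hΨ.constant,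
          subst_eq_linear_add (hg0 i), FormalMap.sum_linearPart_diagonal (hf i),
          FormalMap.sum_linearPart_diagonal (hone hΨ), e4, map_one, one_mul] at c
        rw [FormalMap.comp, FormalMap.comp, subst_eq_linear_add hΨ'.constant,
          subst_eq_linear_add (hg0' i), FormalMap.sum_linearPart_diagonal (hf i),
          FormalMap.sum_linearPart_diagonal (hone hΨ'), map_one, one_mul] at c'
        rw [map_sub, coeff_subst_diag] at e3
        simp only [map_add, map_sub, coeff_C_mul] at c c' e1 e2 e3 ⊢
        linear_combination c - c' - e1 + e2 + e3
      have hΨm : ∀ j Q, Q.degree = m → coeff Q (Ψ j - Ψ' j) = 0 := by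
        intro j Q hQ
        by_cases hm : m < 2
        · exact hlow j Q (by omega)
        by_cases hres : multiPow (eigenWeight μ) Q = eigenWeight μ j
        · rw [map_sub, hΨ.nonlinear j Q (by omega) (isResonant_iff.2 hres),
            hΨ'.nonlinear j Q (by omega) (isResonant_iff.2 hres), sub_self]
        · obtain ⟨i, hi⟩ := Function.ne_iff.1 hres
          rw [multiPow_eigenWeight] at hi
          have hz : coeff Q (g i j - g' i j) = 0 := by
            by_contra hne
            exact hres (((hg i j).sub (hg' i j)) Q hne)
          have := hrel i j Q hQ
          rw [hz, zero_add] at this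
          by_contra hne
          exact hi (mul_right_cancel₀ hne this).symm
      refine ⟨fun j Q hQ => ?_, fun i j Q hQ => ?_⟩
      · rcases (Nat.lt_succ_iff_lt_or_eq).1 hQ with hlt | heq
        · exact ih.1 j Q hlt
        · exact hΨm j Q heq
      · rcases (Nat.lt_succ_iff_lt_or_eq).1 hQ with hlt | heq
        · exact ih.2 i j Q hlt
        · have := hrel i j Q heq
          rw [hΨm j Q heq] at this
          simpa using this.symm
  exact funext fun j => sub_eq_zero.1 (VanishesBelow.eq_zero fun m => (key m).1 j)

end Uniqueness

/-! ### Truncated weighted norms. -/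

namespace MvPowerSeries

variable {n : ℕ}

/-- The weighted `ℓ¹` norm of the part of degree at most `m` of a power series. -/
noncomputable def truncNorm (r : ℝ) (m : ℕ) (S : MvPowerSeries (Fin n) ℂ) : ℝ :=
  ∑ Q ∈ multiIndicesLE n m, ‖coeff Q S‖ * r ^ Q.degree

section TruncNorm

variable {r : ℝ} {m : ℕ} {S T : MvPowerSeries (Fin n) ℂ}

theorem truncNorm_nonneg (hr : 0 ≤ r) : 0 ≤ truncNorm r m S :=
  Finset.sum_nonneg fun _ _ => by positivity

theorem truncNorm_zero : truncNorm r m (0 : MvPowerSeries (Fin n) ℂ) = 0 := by simp [truncNorm]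

theorem truncNorm_le_truncNorm (hr : 0 ≤ r)
    (h : ∀ Q : Fin n →₀ ℕ, Q.degree ≤ m → ‖coeff Q S‖ ≤ ‖coeff Q T‖) :
    truncNorm r m S ≤ truncNorm r m T :=
  Finset.sum_le_sum fun Q hQ =>
    mul_le_mul_of_nonneg_right (h Q (mem_multiIndicesLE.1 hQ)) (by positivity)

theorem truncNorm_add_le (hr : 0 ≤ r) :
    truncNorm r m (S + T) ≤ truncNorm r m S + truncNorm r m T := by
  rw [truncNorm, truncNorm, truncNorm, ← Finset.sum_add_distrib]
  refine Finset.sum_le_sum fun Q _ => ?_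
  rw [← add_mul, map_add]
  exact mul_le_mul_of_nonneg_right (norm_add_le _ _) (by positivity)

theorem truncNorm_C_mul (c : ℂ) : truncNorm r m (C c * S) = ‖c‖ * truncNorm r m S := by
  simp only [truncNorm, coeff_C_mul, norm_mul, Finset.mul_sum, mul_assoc]

theorem truncNorm_neg : truncNorm r m (-S) = truncNorm r m S := by simp [truncNorm]

theorem truncNorm_le_add_sub (hr : 0 ≤ r) :
    truncNorm r m S ≤ truncNorm r m T + truncNorm r m (S - T) := by
  simpa using truncNorm_add_le (S := T) (T := S - T) (m := m) hr

theorem truncNorm_monomial_le (hr : 0 ≤ r) (P : Fin n →₀ ℕ) :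
    truncNorm r m (monomial P 1 : MvPowerSeries (Fin n) ℂ) ≤ r ^ P.degree := by
  have : truncNorm r m (monomial P 1 : MvPowerSeries (Fin n) ℂ) =
      ∑ Q ∈ multiIndicesLE n m, if Q = P then r ^ P.degree else 0 := by
    refine Finset.sum_congr rfl fun Q _ => ?_
    rw [coeff_monomial]
    split_ifs with h
    · simp [h]
    · simp
  rw [this, Finset.sum_ite_eq']
  split_ifs
  · rfl
  · positivity

theorem truncNorm_one_le (hr : 0 ≤ r) : truncNorm r m (1 : MvPowerSeries (Fin n) ℂ) ≤ 1 := by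
  simpa [monomial_zero_one] using truncNorm_monomial_le (m := m) hr (0 : Fin n →₀ ℕ)

theorem truncNorm_X_le (hr : 0 ≤ r) (k : Fin n) :
    truncNorm r m (X k : MvPowerSeries (Fin n) ℂ) ≤ r := by
  simpa [X, Finsupp.degree_single] using
    truncNorm_monomial_le (m := m) hr (Finsupp.single k 1 : Fin n →₀ ℕ)

/-- Only pairs of monomials actually present, with total degree at most `m`, contribute. Information
on the orders of the factors therefore permits truncation degrees smaller than `m`. -/
theorem truncNorm_mul_le_of_degree_le (hr : 0 ≤ r) {a b : ℕ}
    (h : ∀ P R : Fin n →₀ ℕ, P.degree + R.degree ≤ m → coeff P S ≠ 0 → coeff R T ≠ 0 →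
      P.degree ≤ a ∧ R.degree ≤ b) :
    truncNorm r m (S * T) ≤ truncNorm r a S * truncNorm r b T := by
  classical
  set g : (Fin n →₀ ℕ) × (Fin n →₀ ℕ) → ℝ := fun p =>
    (‖coeff p.1 S‖ * r ^ p.1.degree) * (‖coeff p.2 T‖ * r ^ p.2.degree) with hg
  have hg0 : ∀ p, 0 ≤ g p := fun p => by positivity
  have h1 : truncNorm r a S * truncNorm r b T =
      ∑ p ∈ multiIndicesLE n a ×ˢ multiIndicesLE n b, g p := by
    rw [truncNorm, truncNorm, Finset.sum_mul_sum, Finset.sum_product]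
  have h2 : ∀ Q ∈ multiIndicesLE n m, ‖coeff Q (S * T)‖ * r ^ Q.degree ≤
      ∑ p ∈ (multiIndicesLE n a ×ˢ multiIndicesLE n b) with p.1 + p.2 = Q, g p := by
    intro Q hQ
    rw [mem_multiIndicesLE] at hQ
    have h3 : ∑ p ∈ (multiIndicesLE n a ×ˢ multiIndicesLE n b) with p.1 + p.2 = Q, g p =
        ∑ p ∈ Finset.HasAntidiagonal.antidiagonal Q, g p := by
      refine Finset.sum_subset (fun p hp => ?_) fun p hp hp' => ?_
      · rw [Finset.HasAntidiagonal.mem_antidiagonal]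
        exact (Finset.mem_filter.1 hp).2
      · rw [Finset.HasAntidiagonal.mem_antidiagonal] at hp
        by_contra hne
        refine hp' (Finset.mem_filter.2 ⟨?_, hp⟩)
        have hS : coeff p.1 S ≠ 0 := fun h0 => hne (by simp [hg, h0])
        have hT : coeff p.2 T ≠ 0 := fun h0 => hne (by simp [hg, h0])
        have := h p.1 p.2 (by rw [← map_add, hp]; exact hQ) hS hT
        exact Finset.mem_product.2 ⟨mem_multiIndicesLE.2 this.1, mem_multiIndicesLE.2 this.2⟩
    rw [h3, coeff_mul]
    refine (mul_le_mul_of_nonneg_right (norm_sum_le _ _) (by positivity)).trans (le_of_eq ?_)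
    rw [Finset.sum_mul]
    refine Finset.sum_congr rfl fun p hp => ?_
    rw [Finset.HasAntidiagonal.mem_antidiagonal] at hp
    rw [← hp, map_add, pow_add, norm_mul, hg]
    ring
  rw [h1]
  exact (Finset.sum_le_sum h2).trans
    (Finset.sum_fiberwise_le_sum_of_sum_fiber_nonneg fun Q _ => Finset.sum_nonneg fun p _ => hg0 p)

theorem truncNorm_mul_le (hr : 0 ≤ r) :
    truncNorm r m (S * T) ≤ truncNorm r m S * truncNorm r m T :=
  truncNorm_mul_le_of_degree_le hr fun P R h _ _ => ⟨by omega, by omega⟩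

theorem one_le_degree_of_coeff_ne_zero (hS : constantCoeff S = 0) {Q : Fin n →₀ ℕ}
    (hQ : coeff Q S ≠ 0) : 1 ≤ Q.degree := by
  by_contra h
  exact hQ (vanishesBelow_one_iff.2 hS Q (by omega))

/-- A factor without constant term uses up one degree. Thus knowing the multipliers up to degree `m`
is enough to multiply `φ` up to degree `m + 1`. -/
theorem truncNorm_succ_mul_le (hr : 0 ≤ r) (hT : constantCoeff T = 0) :
    truncNorm r (m + 1) (S * T) ≤ truncNorm r m S * truncNorm r (m + 1) T :=
  truncNorm_mul_le_of_degree_le hr fun P R h _ hR => by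
    have := one_le_degree_of_coeff_ne_zero hT hR
    omega

theorem truncNorm_succ_mul_le_mul (hr : 0 ≤ r) (hS : constantCoeff S = 0)
    (hT : constantCoeff T = 0) :
    truncNorm r (m + 1) (S * T) ≤ truncNorm r m S * truncNorm r m T :=
  truncNorm_mul_le_of_degree_le hr fun P R h hP hR => by
    have := one_le_degree_of_coeff_ne_zero hS hP
    have := one_le_degree_of_coeff_ne_zero hT hR
    omega

theorem mul_truncNorm_le_truncNorm_mul_X (hr : 0 ≤ r) (k : Fin n) :
    r * truncNorm r m S ≤ truncNorm r (m + 1) (S * X k) := by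
  classical
  have hinj : Function.Injective fun Q : Fin n →₀ ℕ => Q + Finsupp.single k 1 :=
    add_left_injective _
  have h1 : r * truncNorm r m S = ∑ Q ∈ (multiIndicesLE n m).image fun Q => Q + Finsupp.single k 1,
      ‖coeff Q (S * X k)‖ * r ^ Q.degree := by
    rw [Finset.sum_image hinj.injOn, truncNorm, Finset.mul_sum]
    refine Finset.sum_congr rfl fun Q _ => ?_
    rw [X, coeff_add_mul_monomial, mul_one, map_add, Finsupp.degree_single]
    ring
  rw [h1]
  refine Finset.sum_le_sum_of_subset_of_nonneg (fun Q hQ => ?_) fun _ _ _ => by positivity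
  obtain ⟨P, hP, rfl⟩ := Finset.mem_image.1 hQ
  rw [mem_multiIndicesLE] at hP ⊢
  rw [map_add, Finsupp.degree_single]
  omega

theorem truncNorm_multiPow_le (hr : 0 ≤ r) {Ψ : Fin n → MvPowerSeries (Fin n) ℂ} {s : ℝ}
    (hs : ∀ k, truncNorm r m (Ψ k) ≤ s) (hs0 : 0 ≤ s) (Q : Fin n →₀ ℕ) :
    truncNorm r m (multiPow Ψ Q) ≤ s ^ Q.degree := by
  induction Q using multiIndex_induction with
  | h0 => simpa [multiPow_zero] using truncNorm_one_le (m := m) hr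
  | hs k P ih =>
    rw [multiPow_add, multiPow_single_one, map_add, Finsupp.degree_single, pow_add, pow_one]
    exact (truncNorm_mul_le hr).trans
      (mul_le_mul (hs k) ih (truncNorm_nonneg hr) hs0)

theorem truncNorm_succ_multiPow_le (hr : 0 ≤ r) {Ψ : Fin n → MvPowerSeries (Fin n) ℂ} {s : ℝ}
    (hΨ : ∀ k, constantCoeff (Ψ k) = 0)
    (hs : ∀ k, truncNorm r m (Ψ k) ≤ s) (hs0 : 0 ≤ s) {Q : Fin n →₀ ℕ} (hQ : 2 ≤ Q.degree) :
    truncNorm r (m + 1) (multiPow Ψ Q) ≤ s ^ Q.degree := by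
  have hQ0 : Q ≠ 0 := by rintro rfl; simp at hQ
  obtain ⟨k, P, rfl⟩ := exists_eq_single_add hQ0
  rw [map_add, Finsupp.degree_single] at hQ ⊢
  rw [multiPow_add, multiPow_single_one, pow_add, pow_one]
  exact (truncNorm_succ_mul_le_mul hr (hΨ k) (vanishesBelow_one_iff.1
    ((vanishesBelow_multiPow hΨ P).mono (by omega)))).trans
    (mul_le_mul (hs k) (truncNorm_multiPow_le hr hs hs0 P) (truncNorm_nonneg hr) hs0)

/-- Every monomial of `f` has at least two factors `Ψ k`, none with a constant term. So degree `m`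
information on `Ψ` gives degree `m + 1` information on `f ∘ Ψ`, which is what lets the degree
induction advance. -/
theorem truncNorm_succ_subst_le (hr : 0 ≤ r) {Ψ : Fin n → MvPowerSeries (Fin n) ℂ} {s : ℝ}
    (hΨ : ∀ k, constantCoeff (Ψ k) = 0) (hs : ∀ k, truncNorm r m (Ψ k) ≤ s) (hs0 : 0 ≤ s)
    {f : MvPowerSeries (Fin n) ℂ} (hf : VanishesBelow 2 f) :
    truncNorm r (m + 1) (subst Ψ f) ≤ truncNorm s (m + 1) f := by
  calc truncNorm r (m + 1) (subst Ψ f)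
      ≤ ∑ P ∈ multiIndicesLE n (m + 1), ∑ Q ∈ multiIndicesLE n (m + 1),
          ‖coeff Q f‖ * (‖coeff P (multiPow Ψ Q)‖ * r ^ P.degree) := by
        refine Finset.sum_le_sum fun P hP => ?_
        rw [coeff_subst_eq_sum hΨ f (mem_multiIndicesLE.1 hP)]
        refine (mul_le_mul_of_nonneg_right (norm_sum_le _ _) (by positivity)).trans (le_of_eq ?_)
        rw [Finset.sum_mul]
        exact Finset.sum_congr rfl fun Q _ => by rw [norm_mul, mul_assoc]
    _ = ∑ Q ∈ multiIndicesLE n (m + 1), ‖coeff Q f‖ * truncNorm r (m + 1) (multiPow Ψ Q) := by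
        rw [Finset.sum_comm]
        exact Finset.sum_congr rfl fun Q _ => by rw [truncNorm, Finset.mul_sum]
    _ ≤ truncNorm s (m + 1) f := by
        refine Finset.sum_le_sum fun Q _ => ?_
        by_cases hQ : 2 ≤ Q.degree
        · exact mul_le_mul_of_nonneg_left (truncNorm_succ_multiPow_le hr hΨ hs hs0 hQ)
            (norm_nonneg _)
        · simp [hf Q (by omega)]

/-- The source of smallness: a series of order 2 shrinks quadratically with the radius. -/
theorem truncNorm_le_sq_mul {s ρ : ℝ} (hs : 0 ≤ s) (hρ : 0 < ρ) (hsρ : s ≤ ρ)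
    {f : MvPowerSeries (Fin n) ℂ} (hf : VanishesBelow 2 f) :
    truncNorm s m f ≤ (s / ρ) ^ 2 * truncNorm ρ m f := by
  rw [truncNorm, truncNorm, Finset.mul_sum]
  refine Finset.sum_le_sum fun Q _ => ?_
  by_cases hQ : 2 ≤ Q.degree
  · have h1 : (s / ρ) ^ Q.degree ≤ (s / ρ) ^ 2 :=
      pow_le_pow_of_le_one (by positivity) ((div_le_one hρ).2 hsρ) hQ
    have h2 : s ^ Q.degree = (s / ρ) ^ Q.degree * ρ ^ Q.degree := by
      rw [← mul_pow, div_mul_cancel₀ _ hρ.ne']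
    rw [h2]
    calc ‖coeff Q f‖ * ((s / ρ) ^ Q.degree * ρ ^ Q.degree)
        ≤ ‖coeff Q f‖ * ((s / ρ) ^ 2 * ρ ^ Q.degree) := by gcongr
      _ = _ := by ring
  · simp [hf Q (by omega)]

theorem truncNorm_sub_linPart_le (hr : 0 ≤ r) (f : MvPowerSeries (Fin n) ℂ) :
    truncNorm r m (f - linPart f) ≤ truncNorm r m f := by
  refine truncNorm_le_truncNorm hr fun Q _ => ?_
  by_cases hQ : Q.degree = 1
  · obtain ⟨k, rfl⟩ := exists_eq_single_of_degree_eq_one hQ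
    rw [map_sub, coeff_single_linPart, sub_self, norm_zero]
    exact norm_nonneg _
  · rw [map_sub, linPart, map_sum, Finset.sum_eq_zero fun k _ => coeff_C_mul_X_of_degree_ne _ k hQ,
      sub_zero]

/-- The norm is additive along the decomposition according to the values of a function of the
exponent. -/
theorem exists_truncNorm_eq_sum_restrict {W : Type*} (w : (Fin n →₀ ℕ) → W) (r : ℝ) (m : ℕ) :
    ∃ s : Finset W, ∀ S : MvPowerSeries (Fin n) ℂ,
      truncNorm r m S = ∑ v ∈ s, truncNorm r m (restrict {Q | w Q = v} S) := by
  classical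
  refine ⟨(multiIndicesLE n m).image w, fun S => ?_⟩
  rw [truncNorm, ← Finset.sum_fiberwise_of_maps_to fun Q hQ => Finset.mem_image_of_mem w hQ]
  refine Finset.sum_congr rfl fun v _ => ?_
  rw [truncNorm, Finset.sum_filter]
  refine Finset.sum_congr rfl fun Q _ => ?_
  split_ifs with h
  · rw [coeff_restrict_of_mem (A := {Q | w Q = v}) S h]
  · rw [coeff_restrict_of_notMem (A := {Q | w Q = v}) S h, norm_zero, zero_mul]

end TruncNorm

/-! ### Multiplication by monomials in perturbed eigenvalues. -/

section Multiplier

variable {r δ : ℝ} {m : ℕ} {μ : Fin n → ℂ} {M : Fin n → MvPowerSeries (Fin n) ℂ}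

theorem truncNorm_multiPow_sub_le (hr : 0 ≤ r) (hδ : 0 ≤ δ)
    (hM : ∀ k, truncNorm r m (M k - C (μ k)) ≤ ‖μ k‖ * δ) (Q : Fin n →₀ ℕ) :
    truncNorm r m (multiPow M Q - C (multiPow μ Q)) ≤
      ‖multiPow μ Q‖ * ((1 + δ) ^ Q.degree - 1) := by
  induction Q using multiIndex_induction with
  | h0 => simp [multiPow_zero, truncNorm_zero]
  | hs k P ih =>
    rw [multiPow_add, multiPow_single_one, multiPow_add, multiPow_single_one, map_add,
      Finsupp.degree_single, pow_add, pow_one, norm_mul]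
    have e : M k * multiPow M P - C (μ k * multiPow μ P) =
        (M k - C (μ k)) * multiPow M P + C (μ k) * (multiPow M P - C (multiPow μ P)) := by
      rw [map_mul]; ring
    have hP : truncNorm r m (multiPow M P) ≤ ‖multiPow μ P‖ * (1 + δ) ^ P.degree := by
      have h1 := truncNorm_le_add_sub (S := multiPow M P) (T := C (multiPow μ P)) (m := m) hr
      have h2 : truncNorm r m (C (multiPow μ P) : MvPowerSeries (Fin n) ℂ) ≤ ‖multiPow μ P‖ := by
        have := truncNorm_C_mul (r := r) (m := m) (S := (1 : MvPowerSeries (Fin n) ℂ))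
          (multiPow μ P)
        rw [mul_one] at this
        rw [this]
        exact mul_le_of_le_one_right (norm_nonneg _) (truncNorm_one_le hr)
      linarith
    rw [e]
    refine (truncNorm_add_le hr).trans ?_
    rw [truncNorm_C_mul]
    have h3 := (truncNorm_mul_le (S := M k - C (μ k)) (T := multiPow M P) (m := m) hr).trans
      (mul_le_mul (hM k) hP (truncNorm_nonneg hr) (by positivity))
    have h4 := mul_le_mul_of_nonneg_left ih (norm_nonneg (μ k))
    calc _ ≤ ‖μ k‖ * δ * (‖multiPow μ P‖ * (1 + δ) ^ P.degree) +
          ‖μ k‖ * (‖multiPow μ P‖ * ((1 + δ) ^ P.degree - 1)) := add_le_add h3 h4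
      _ = _ := by ring

/-- Each factor `M k` is `μ k` plus a perturbation of relative size `δ`, so multiplying by it
shrinks the norm at worst by `‖μ k‖ * (1 - δ)`. -/
theorem le_truncNorm_multiPow_mul (hr : 0 ≤ r) (hδ : δ ≤ 1)
    (hM : ∀ k, truncNorm r m (M k - C (μ k)) ≤ ‖μ k‖ * δ) (Q : Fin n →₀ ℕ)
    {S : MvPowerSeries (Fin n) ℂ} (hS : constantCoeff S = 0) :
    ‖multiPow μ Q‖ * (1 - δ) ^ Q.degree * truncNorm r (m + 1) S ≤
      truncNorm r (m + 1) (multiPow M Q * S) := by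
  induction Q using multiIndex_induction with
  | h0 => simp [multiPow_zero]
  | hs k P ih =>
    rw [multiPow_add, multiPow_single_one, multiPow_add, multiPow_single_one, map_add,
      Finsupp.degree_single, pow_add, pow_one, norm_mul]
    set T := multiPow M P * S with hT
    have hT0 : constantCoeff T = 0 := by rw [hT, map_mul, hS, mul_zero]
    have h1 := truncNorm_le_add_sub (S := C (μ k) * T) (T := M k * T) (m := m + 1) hr
    have e : C (μ k) * T - M k * T = -((M k - C (μ k)) * T) := by ring
    rw [e, truncNorm_neg, truncNorm_C_mul] at h1
    have h2 := (truncNorm_succ_mul_le (S := M k - C (μ k)) (m := m) hr hT0).trans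
      (mul_le_mul_of_nonneg_right (hM k) (truncNorm_nonneg hr))
    have h3 := mul_le_mul_of_nonneg_left ih
      (mul_nonneg (norm_nonneg (μ k)) (sub_nonneg.2 hδ))
    rw [mul_assoc (M k)]
    calc _ = ‖μ k‖ * (1 - δ) * (‖multiPow μ P‖ * (1 - δ) ^ P.degree * truncNorm r (m + 1) S) := by
          ring
      _ ≤ ‖μ k‖ * (1 - δ) * truncNorm r (m + 1) T := h3
      _ ≤ _ := by linarith

/-- Two regimes. Either `M ^ Q` is so large that it dominates `ν`, or `M ^ Q` deviates from `μ ^ Q`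
by less than the divisor `μ ^ Q - ν`. -/
theorem le_truncNorm_multiPow_sub_mul (hr : 0 ≤ r) (hδ0 : 0 ≤ δ) (hδ : δ ≤ 1)
    (hM : ∀ k, truncNorm r m (M k - C (μ k)) ≤ ‖μ k‖ * δ) {Q : Fin n →₀ ℕ} {ν : ℂ} {b : ℝ}
    (hb : b ≤ ‖multiPow μ Q‖ * (1 - δ) ^ Q.degree - ‖ν‖ ∨
      b ≤ ‖multiPow μ Q - ν‖ - ‖multiPow μ Q‖ * ((1 + δ) ^ Q.degree - 1))
    {S : MvPowerSeries (Fin n) ℂ} (hS : constantCoeff S = 0) :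
    b * truncNorm r (m + 1) S ≤ truncNorm r (m + 1) ((multiPow M Q - C ν) * S) := by
  have h0 : 0 ≤ truncNorm r (m + 1) S := truncNorm_nonneg hr
  rcases hb with hb | hb
  · have h1 := le_truncNorm_multiPow_mul hr hδ hM Q hS
    have h2 := truncNorm_le_add_sub (S := multiPow M Q * S) (T := (multiPow M Q - C ν) * S)
      (m := m + 1) hr
    have e : multiPow M Q * S - (multiPow M Q - C ν) * S = C ν * S := by ring
    rw [e, truncNorm_C_mul] at h2
    have h3 := mul_le_mul_of_nonneg_right hb h0
    rw [sub_mul] at h3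
    linarith
  · have h1 := (truncNorm_succ_mul_le (m := m) hr hS).trans
      (mul_le_mul_of_nonneg_right (truncNorm_multiPow_sub_le hr hδ0 hM Q) h0)
    have h2 := truncNorm_le_add_sub (S := C (multiPow μ Q - ν) * S)
      (T := (multiPow M Q - C ν) * S) (m := m + 1) hr
    have e : C (multiPow μ Q - ν) * S - (multiPow M Q - C ν) * S =
        -((multiPow M Q - C (multiPow μ Q)) * S) := by rw [map_sub]; ring
    rw [e, truncNorm_neg, truncNorm_C_mul] at h2
    have h3 := mul_le_mul_of_nonneg_right hb h0
    rw [sub_mul] at h3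
    linarith

end Multiplier

end MvPowerSeries

/-! ### The Poincaré gap and the uniform bound on the transformation. -/

section Estimate

open MvPowerSeries

variable {n l : ℕ}

/-- The two alternatives are the hypotheses of `le_truncNorm_multiPow_sub_mul`. For large `Q'` the
exponential growth or decay of `μ_i ^ Q'` beats the perturbation factors `(1 ± δ) ^ |Q'|`; the
finitely many remaining `Q'` are handled by shrinking `δ` and `b`. -/
theorem PoincareType.exists_gap {μ : Fin l → Fin n → ℂ} (hμ : ∀ i j, μ i j ≠ 0)
    (hP : PoincareType μ) :
    ∃ δ b : ℝ, 0 < δ ∧ δ ≤ 1 ∧ 0 < b ∧ ∀ (j : Fin n) (Q : Fin n →₀ ℕ),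
      multiPow (eigenWeight μ) Q ≠ eigenWeight μ j → ∃ (i : Fin l) (Q' : Fin n →₀ ℕ),
        multiPow (eigenWeight μ) Q' = multiPow (eigenWeight μ) Q ∧ (Q ≤ Q' ∨ Q' ≤ Q) ∧
        (b ≤ ‖multiPow (μ i) Q'‖ * (1 - δ) ^ Q'.degree - ‖μ i j‖ ∨
          b ≤ ‖multiPow (μ i) Q' - μ i j‖ -
            ‖multiPow (μ i) Q'‖ * ((1 + δ) ^ Q'.degree - 1)) := by
  obtain ⟨d, c, hd, hc, hP⟩ := hP
  -- The rate `d` is split as `s * s`: one factor absorbs the perturbation, the other beats the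
  -- constants.
  set s := √d with hs
  have hs1 : 1 < s := by rw [hs]; exact Real.lt_sqrt_of_sq_lt (by simpa using hd)
  have hs0 : 0 < s := by linarith
  have hsd : s * s = d := Real.mul_self_sqrt (by linarith)
  have hinv0 : 0 < s⁻¹ := inv_pos.2 hs0
  have hinv1 : s⁻¹ < 1 := inv_lt_one_of_one_lt₀ hs1
  have hN : ∀ᶠ N : ℕ in atTop, ∀ i j, ‖μ i j‖ + 1 ≤ c⁻¹ * s ^ N ∧ c * s⁻¹ ^ N ≤ ‖μ i j‖ / 2 := by
    refine eventually_all.2 fun i => eventually_all.2 fun j => ?_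
    have h1 : Tendsto (fun N : ℕ => c⁻¹ * s ^ N) atTop atTop :=
      (tendsto_pow_atTop_atTop_of_one_lt hs1).const_mul_atTop (inv_pos.2 hc)
    have h2 : Tendsto (fun N : ℕ => c * s⁻¹ ^ N) atTop (𝓝 (c * 0)) :=
      (tendsto_pow_atTop_nhds_zero_of_lt_one hinv0.le hinv1).const_mul c
    have h3 : c * 0 < ‖μ i j‖ / 2 := by
      have := norm_pos_iff.2 (hμ i j)
      rw [mul_zero]; positivity
    exact (h1.eventually_ge_atTop _).and (h2.eventually_le_const h3)
  obtain ⟨N₀, hN₀⟩ := eventually_atTop.1 hN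
  -- The bound `δ ≤ 1 - s⁻¹` gives both `s⁻¹ ≤ 1 - δ` and `1 + δ ≤ s`.
  have hδ : ∀ᶠ δ : ℝ in 𝓝[>] 0, 0 < δ ∧ δ ≤ 1 - s⁻¹ ∧ ∀ i j, ∀ Q ∈ multiIndicesLE n N₀,
      multiPow (μ i) Q ≠ μ i j →
      ‖multiPow (μ i) Q‖ * ((1 + δ) ^ Q.degree - 1) ≤ ‖multiPow (μ i) Q - μ i j‖ / 2 := by
    refine eventually_mem_nhdsWithin.and (Eventually.and ?_ ?_)
    · exact (eventually_le_nhds (sub_pos.2 hinv1)).filter_mono nhdsWithin_le_nhds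
    · refine eventually_all.2 fun i => eventually_all.2 fun j => (Finset.eventually_all _).2
        fun Q _ => ?_
      by_cases hne : multiPow (μ i) Q = μ i j
      · exact Eventually.of_forall fun δ h => absurd hne h
      have h1 : Tendsto (fun δ : ℝ => ‖multiPow (μ i) Q‖ * ((1 + δ) ^ Q.degree - 1)) (𝓝[>] 0)
          (𝓝 (‖multiPow (μ i) Q‖ * ((1 + 0) ^ Q.degree - 1))) :=
        tendsto_nhdsWithin_of_tendsto_nhds (Continuous.tendsto (by fun_prop) 0)
      refine (h1.eventually_le_const ?_).mono fun δ h _ => h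
      have := norm_pos_iff.2 (sub_ne_zero.2 hne)
      simp only [add_zero, one_pow, sub_self, mul_zero]
      positivity
  obtain ⟨δ, hδ0, hδ1, hδQ⟩ := hδ.exists
  have hb : ∀ᶠ b : ℝ in 𝓝[>] 0, 0 < b ∧ b ≤ 1 ∧ ∀ i j, b ≤ ‖μ i j‖ / 2 ∧
      ∀ Q ∈ multiIndicesLE n N₀, multiPow (μ i) Q ≠ μ i j →
      b ≤ ‖multiPow (μ i) Q - μ i j‖ / 2 := by
    have hle : ∀ x : ℝ, 0 < x → ∀ᶠ b in 𝓝[>] (0 : ℝ), b ≤ x := fun x hx =>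
      (eventually_le_nhds hx).filter_mono nhdsWithin_le_nhds
    refine eventually_mem_nhdsWithin.and ((hle 1 one_pos).and
      (eventually_all.2 fun i => eventually_all.2 fun j => (hle _ ?_).and
        ((Finset.eventually_all _).2 fun Q _ => ?_)))
    · exact half_pos (norm_pos_iff.2 (hμ i j))
    · by_cases hne : multiPow (μ i) Q = μ i j
      · exact Eventually.of_forall fun δ h => absurd hne h
      · exact (hle _ (half_pos (norm_pos_iff.2 (sub_ne_zero.2 hne)))).mono fun _ h _ => h
  obtain ⟨b, hb0, hb1, hbμ⟩ := hb.exists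
  refine ⟨δ, b, hδ0, by linarith, hb0, fun j Q hQ => ?_⟩
  obtain ⟨i, Q', hw, hne, hlt, hcmp⟩ := hP j Q (fun h => hQ (isResonant_iff.1 h))
  refine ⟨i, Q', funext fun k => ?_, hcmp, ?_⟩
  · rw [multiPow_eigenWeight, multiPow_eigenWeight]; exact hw k
  change multiPow (μ i) Q' ≠ μ i j at hne
  change c⁻¹ * d ^ Q'.degree < max ‖multiPow (μ i) Q'‖ ‖(multiPow (μ i) Q')⁻¹‖ at hlt
  set z := multiPow (μ i) Q' with hz
  set N := Q'.degree with hNdef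
  rcases le_or_gt N N₀ with hle | hgt
  · right
    have h1 := hδQ i j Q' (mem_multiIndicesLE.2 hle) hne
    have h2 := (hbμ i j).2 Q' (mem_multiIndicesLE.2 hle) hne
    linarith
  obtain ⟨hbig, hsmall⟩ := hN₀ N hgt.le i j
  have hpow : (s * s) ^ N = s ^ N * s ^ N := mul_pow _ _ _
  have hsN : 0 < s ^ N := by positivity
  have hcancel : s ^ N * s⁻¹ ^ N = 1 := by rw [← mul_pow, mul_inv_cancel₀ hs0.ne', one_pow]
  rw [← hsd, hpow] at hlt
  rcases lt_max_iff.1 hlt with hlt | hlt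
  · left
    have h1 : s⁻¹ ^ N ≤ (1 - δ) ^ N := pow_le_pow_left₀ hinv0.le (by linarith) N
    have h2 : c⁻¹ * s ^ N ≤ ‖z‖ * (1 - δ) ^ N := by
      calc c⁻¹ * s ^ N = c⁻¹ * (s ^ N * s ^ N) * s⁻¹ ^ N := by
            rw [mul_assoc, mul_assoc, hcancel, mul_one]
        _ ≤ ‖z‖ * (1 - δ) ^ N := mul_le_mul hlt.le h1 (by positivity) (norm_nonneg _)
    linarith
  · right
    have hz0 : 0 < ‖z‖ := by
      rw [norm_pos_iff]
      rintro h0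
      rw [h0, inv_zero, norm_zero] at hlt
      have : 0 < c⁻¹ * (s ^ N * s ^ N) := by positivity
      linarith
    have h1 : (1 + δ) ^ N ≤ s ^ N := by
      refine pow_le_pow_left₀ (by linarith) ?_ N
      have h2 : (1 - s⁻¹) * 1 ≤ (1 - s⁻¹) * s :=
        mul_le_mul_of_nonneg_left hs1.le (by linarith)
      rw [mul_one, sub_mul, inv_mul_cancel₀ hs0.ne'] at h2
      linarith
    have h3 : ‖z‖ * s ^ N ≤ c * s⁻¹ ^ N := by
      rw [norm_inv] at hlt
      have h4 : ‖z‖ * (c⁻¹ * (s ^ N * s ^ N)) ≤ 1 := by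
        rw [← mul_inv_cancel₀ hz0.ne']
        exact mul_le_mul_of_nonneg_left hlt.le hz0.le
      calc ‖z‖ * s ^ N = ‖z‖ * (c⁻¹ * (s ^ N * s ^ N)) * (c * s⁻¹ ^ N) := by
            rw [show ‖z‖ * (c⁻¹ * (s ^ N * s ^ N)) * (c * s⁻¹ ^ N) =
              ‖z‖ * s ^ N * (c⁻¹ * c) * (s ^ N * s⁻¹ ^ N) by ring, hcancel,
              inv_mul_cancel₀ hc.ne']
            ring
        _ ≤ 1 * (c * s⁻¹ ^ N) := mul_le_mul_of_nonneg_right h4 (by positivity)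
        _ = _ := one_mul _
    have h5 : ‖μ i j‖ - ‖z‖ ≤ ‖z - μ i j‖ := by
      rw [norm_sub_rev]; exact norm_sub_norm_le _ _
    have h6 := mul_le_mul_of_nonneg_left h1 hz0.le
    have h7 := (hbμ i j).1
    linarith

theorem IsIntegrableMultiplier.ne_zero {μ : Fin l → Fin n → ℂ} (hμ : ∀ i j, μ i j ≠ 0)
    {M : Fin l → Fin n → MvPowerSeries (Fin n) ℂ} (hM : IsIntegrableMultiplier μ M) (i : Fin l)
    (j : Fin n) : M i j ≠ 0 := fun h0 => hμ i j (by rw [← hM.value, h0, map_zero])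

/-- The multipliers are invariant under resonant shifts. -/
theorem IsIntegrableMultiplier.multiPow_eq_one {μ : Fin l → Fin n → ℂ} (hμ : ∀ i j, μ i j ≠ 0)
    {M : Fin l → Fin n → MvPowerSeries (Fin n) ℂ} (hM : IsIntegrableMultiplier μ M)
    {P : Fin n →₀ ℕ} (hP : multiPow (eigenWeight μ) P = 1) (i : Fin l) :
    multiPow (M i) P = 1 := by
  by_cases h0 : P = 0
  · rw [h0, multiPow_zero]
  -- Here `P ≠ 0` only supplies some index `j`; then `P + e_j` is resonant for `j`, and `M i j`
  -- cancels.
  obtain ⟨j, -, -⟩ := exists_eq_single_add h0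
  have := hM.resonance j (P + Finsupp.single j 1)
    (by rw [multiPow_add, hP, one_mul, multiPow_single_one]) i
  rw [multiPow_add, multiPow_single_one] at this
  exact mul_right_cancel₀ (hM.ne_zero hμ i j) (this.trans (one_mul _).symm)

theorem multiPow_eigenWeight_ne_zero {μ : Fin l → Fin n → ℂ} (hμ : ∀ i j, μ i j ≠ 0)
    (Q : Fin n →₀ ℕ) (i : Fin l) : multiPow (eigenWeight μ) Q i ≠ 0 := by
  rw [multiPow_eigenWeight]
  exact Finset.prod_ne_zero_iff.2 fun k _ => pow_ne_zero _ (hμ i k)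

/-- Comparability makes the difference of the exponents a genuine multi-index of weight 1, to which
`multiPow_eq_one` applies. This is the role of the last clause of `PoincareType`. -/
theorem IsIntegrableMultiplier.multiPow_eq {μ : Fin l → Fin n → ℂ} (hμ : ∀ i j, μ i j ≠ 0)
    {M : Fin l → Fin n → MvPowerSeries (Fin n) ℂ} (hM : IsIntegrableMultiplier μ M)
    {Q Q' : Fin n →₀ ℕ} (hw : multiPow (eigenWeight μ) Q' = multiPow (eigenWeight μ) Q)
    (hcmp : Q ≤ Q' ∨ Q' ≤ Q) (i : Fin l) : multiPow (M i) Q' = multiPow (M i) Q := by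
  have key : ∀ {Q Q' : Fin n →₀ ℕ}, multiPow (eigenWeight μ) Q' = multiPow (eigenWeight μ) Q →
      Q ≤ Q' → multiPow (M i) Q' = multiPow (M i) Q := by
    intro Q Q' hw h
    obtain ⟨P, rfl⟩ := exists_add_of_le h
    rw [multiPow_add] at hw ⊢
    rw [hM.multiPow_eq_one hμ (P := P), mul_one]
    funext k
    have := congrFun hw k
    exact mul_left_cancel₀ (multiPow_eigenWeight_ne_zero hμ Q k) (this.trans (mul_one _).symm)
  exact hcmp.elim (key hw) fun h => (key hw.symm h).symm

/-- The weights of the variables under the normal form itself. -/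
def multiplierWeight (M : Fin l → Fin n → MvPowerSeries (Fin n) ℂ) :
    Fin n → Fin l → MvPowerSeries (Fin n) ℂ := fun k i => M i k

theorem multiPow_multiplierWeight (M : Fin l → Fin n → MvPowerSeries (Fin n) ℂ) (Q : Fin n →₀ ℕ)
    (i : Fin l) : multiPow (multiplierWeight M) Q i = multiPow (M i) Q := by
  rw [multiPow_apply]; rfl

/-- Constant terms recover the eigenvalues. So the classes of equal multipliers refine those of
equal eigenvalues, and each class is entirely resonant or entirely nonresonant for a given `j`. -/
theorem IsIntegrableMultiplier.eigenWeight_eq {μ : Fin l → Fin n → ℂ}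
    {M : Fin l → Fin n → MvPowerSeries (Fin n) ℂ} (hM : IsIntegrableMultiplier μ M)
    {Q Q' : Fin n →₀ ℕ}
    (h : multiPow (multiplierWeight M) Q = multiPow (multiplierWeight M) Q') :
    multiPow (eigenWeight μ) Q = multiPow (eigenWeight μ) Q' := by
  have e : ∀ i (R : Fin n →₀ ℕ), constantCoeff (multiPow (M i) R) = multiPow (μ i) R :=
    fun i R => by
      have := map_multiPow (constantCoeff (σ := Fin n) (R := ℂ)).toMonoidHom (M i) R
      simpa [hM.value] using this
  funext i
  rw [multiPow_eigenWeight, multiPow_eigenWeight, ← e, ← e, ← multiPow_multiplierWeight,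
    ← multiPow_multiplierWeight, h]

theorem IsIntegrableMultiplier.multiplier_homog_mul_X {μ : Fin l → Fin n → ℂ}
    (hμ : ∀ i j, μ i j ≠ 0) {M : Fin l → Fin n → MvPowerSeries (Fin n) ℂ}
    (hM : IsIntegrableMultiplier μ M) (i : Fin l) (k : Fin n) :
    Homog (multiplierWeight M) (multiplierWeight M k) (M i k * X k) := by
  have h1 : Homog (multiplierWeight M) 1 (M i k) := fun Q hQ => by
    funext i'
    rw [multiPow_multiplierWeight, hM.multiPow_eq_one hμ (hM.homog i k Q hQ)]
    rfl
  simpa using h1.mul (Homog.X k)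

/-- The homological equation, on each class of monomials having the same multipliers. -/
theorem multiplier_mul_restrict {μ : Fin l → Fin n → ℂ} (hμ : ∀ i j, μ i j ≠ 0)
    {M : Fin l → Fin n → MvPowerSeries (Fin n) ℂ} (hM : IsIntegrableMultiplier μ M) (i : Fin l)
    (j : Fin n) {φ h : MvPowerSeries (Fin n) ℂ}
    (heq : h = (M i j - C (μ i j)) * X j +
      (subst (fun k => M i k * X k) φ - C (μ i j) * φ)) {Q : Fin n →₀ ℕ}
    (hQ : multiPow (eigenWeight μ) Q ≠ eigenWeight μ j) :
    (multiPow (M i) Q - C (μ i j)) *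
        restrict {P | multiPow (multiplierWeight M) P = multiPow (multiplierWeight M) Q} φ =
      restrict {P | multiPow (multiplierWeight M) P = multiPow (multiplierWeight M) Q} h := by
  set A := {P : Fin n →₀ ℕ | multiPow (multiplierWeight M) P = multiPow (multiplierWeight M) Q}
    with hA
  have hMX0 : ∀ k, constantCoeff (M i k * X k) = 0 := by simp
  have hMX := hM.multiplier_homog_mul_X hμ i
  have hφA : Homog (multiplierWeight M) (multiPow (multiplierWeight M) Q) (restrict A φ) :=
    fun P hP => by
      by_contra hn
      exact hP (coeff_restrict_of_notMem _ hn)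
  have h1 : subst (fun k => M i k * X k) (restrict A φ) = multiPow (M i) Q * restrict A φ :=
    subst_mul_X fun P hP => by
      rw [← multiPow_multiplierWeight, hφA P hP, multiPow_multiplierWeight]
  rw [sub_mul, ← h1]
  have h2 := hφA.subst hMX0 hMX
  ext P
  by_cases hP : P ∈ A
  · rw [coeff_restrict_of_mem _ hP, heq, map_sub, map_add, map_sub, coeff_C_mul, coeff_C_mul,
      coeff_restrict_of_mem _ hP]
    have h3 : coeff P ((M i j - C (μ i j)) * X j) = 0 := by
      by_contra hne
      have hh : Homog (eigenWeight μ) (1 * eigenWeight μ j) ((M i j - C (μ i j)) * X j) :=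
        ((hM.homog i j).sub (Homog.C _)).mul (Homog.X j)
      rw [one_mul] at hh
      exact hQ ((hM.eigenWeight_eq hP).symm.trans (hh P hne))
    -- The normal form preserves multiplier weights, so the other classes of `φ` do not enter class
    -- `A`.
    have h4 : coeff P (subst (fun k => M i k * X k) (φ - restrict A φ)) = 0 := by
      by_contra hne
      obtain ⟨R, hR, hRP⟩ := exists_multiPow_eq_of_coeff_subst_ne_zero hMX0 hMX hne
      refine hR ?_
      rw [map_sub, coeff_restrict_of_mem (A := A) _ (hRP.trans hP), sub_self]
    rw [subst_sub (hasSubst_of_constantCoeff_zero hMX0), map_sub, sub_eq_zero] at h4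
    rw [h3, zero_add, h4]
  · rw [coeff_restrict_of_notMem _ hP, map_sub, coeff_C_mul, coeff_restrict_of_notMem _ hP,
      mul_zero, sub_zero]
    by_contra hne
    exact hP (h2 P hne)

/-- Induction on the truncation degree at one fixed radius `r`: the nonlinear part of `f`
contributes `O(r²)`, and dividing by the uniform gap `b` keeps the norm of `Ψ - id` at most `r`. -/
theorem exists_truncNorm_bound {μ : Fin l → Fin n → ℂ} (hμ : ∀ i j, μ i j ≠ 0)
    (hP : PoincareType μ) {f : Fin l → FormalMap n} (hf0 : ∀ i j, constantCoeff (f i j) = 0)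
    (hf : ∀ i, (f i).linearPart = Matrix.diagonal (μ i)) {ρ K : ℝ} (hρ : 0 < ρ)
    (hK : ∀ i j m, truncNorm ρ m (f i j) ≤ K) {Ψ : FormalMap n}
    {M : Fin l → Fin n → MvPowerSeries (Fin n) ℂ} (hΨ : IsNormalized μ Ψ)
    (hM : IsIntegrableMultiplier μ M)
    (hconj : ∀ i, (f i).comp Ψ = Ψ.comp (fun j => M i j * X j)) :
    ∃ r : ℝ, 0 < r ∧ (∀ m j, truncNorm r m (Ψ j) ≤ 2 * r) ∧
      ∀ m i j, truncNorm r m (M i j) ≤ 2 * ‖μ i j‖ := by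
  obtain ⟨δ, b, hδ0, hδ1, hb0, hgap⟩ := hP.exists_gap hμ
  -- The conditions on `r` ensure, in order: `Ψ`, of norm at most `2 * r`, stays within radius `ρ`;
  -- the multipliers stay `δ`-close to the eigenvalues; the sum over the `l` maps, divided by `b`,
  -- is at most `r`.
  have hr : ∀ᶠ r : ℝ in 𝓝[>] 0, 0 < r ∧ r ≤ ρ / 2 ∧
      (∀ i j, K * (2 / ρ) ^ 2 * r ≤ ‖μ i j‖ * δ) ∧ l * (K * (2 / ρ) ^ 2) * r ≤ b := by
    have hle : ∀ a x : ℝ, 0 < x → ∀ᶠ r in 𝓝[>] (0 : ℝ), a * r ≤ x := fun a x hx => by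
      have : Tendsto (fun r : ℝ => a * r) (𝓝[>] 0) (𝓝 (a * 0)) :=
        tendsto_nhdsWithin_of_tendsto_nhds (Continuous.tendsto (by fun_prop) 0)
      exact this.eventually_le_const (by simpa using hx)
    have hpos : ∀ᶠ r : ℝ in 𝓝[>] 0, 0 < r := eventually_mem_nhdsWithin
    refine hpos.and (Eventually.and ?_ (Eventually.and ?_ ?_))
    · simpa using hle 1 (ρ / 2) (by positivity)
    · exact eventually_all.2 fun i => eventually_all.2 fun j =>
        hle _ _ (mul_pos (norm_pos_iff.2 (hμ i j)) hδ0)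
    · exact hle _ _ hb0
  obtain ⟨r, hr0, hrρ, hrμ, hrb⟩ := hr.exists
  set H := K * (2 / ρ) ^ 2 * r * r with hH
  set φ : FormalMap n := fun j => Ψ j - X j with hφ
  have hφ2 : ∀ j, VanishesBelow 2 (φ j) := fun j =>
    vanishesBelow_two_sub_of_linear_eq (hΨ.constant j) (by simp) fun k => by
      rw [coeff_X]
      refine (congrFun (congrFun hΨ.linear j) k).trans ?_
      simp [Matrix.one_apply, Finsupp.single_left_inj, eq_comm]
  have hφ0 : ∀ j, constantCoeff (φ j) = 0 := fun j =>
    vanishesBelow_one_iff.1 ((hφ2 j).mono one_le_two)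
  have hφres : ∀ j Q, coeff Q (φ j) ≠ 0 → multiPow (eigenWeight μ) Q ≠ eigenWeight μ j := by
    intro j Q hQ hw
    have hd : 2 ≤ Q.degree := by
      by_contra hlt
      exact hQ (hφ2 j Q (by omega))
    refine hQ ?_
    rw [hφ, map_sub, hΨ.nonlinear j Q hd (isResonant_iff.2 hw), coeff_X, if_neg, sub_zero]
    rintro rfl
    simp [Finsupp.degree_single] at hd
  set h : Fin l → FormalMap n := fun i j => subst Ψ (f i j - linPart (f i j)) with hh
  have heq : ∀ i j, h i j = (M i j - C (μ i j)) * X j +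
      (subst (fun k => M i k * X k) (φ j) - C (μ i j) * φ j) := by
    intro i j
    have hMX0 : ∀ k, constantCoeff (M i k * X k) = 0 := by simp
    have hs := hasSubst_of_constantCoeff_zero hMX0
    have c := congrFun (hconj i) j
    rw [FormalMap.comp, FormalMap.comp, subst_eq_linear_add hΨ.constant,
      FormalMap.sum_linearPart_diagonal (hf i)] at c
    simp only [hh, hφ]
    rw [subst_sub hs, subst_X hs, ← c]
    ring
  have hstep : ∀ m, (∀ j, truncNorm r m (φ j) ≤ r) →
      (∀ i j, truncNorm r (m + 1) (h i j) ≤ H) ∧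
        ∀ i j, truncNorm r m (M i j - C (μ i j)) ≤ ‖μ i j‖ * δ := by
    intro m ih
    have hΨm : ∀ k, truncNorm r m (Ψ k) ≤ 2 * r := fun k => by
      have := truncNorm_le_add_sub (S := Ψ k) (T := X k) (m := m) hr0.le
      have := truncNorm_X_le (n := n) (m := m) hr0.le k
      have := ih k
      simp only [hφ] at this
      linarith
    have hHb : ∀ i j, truncNorm r (m + 1) (h i j) ≤ H := fun i j => by
      have h2 := vanishesBelow_two_sub_linPart (hf0 i j)
      calc truncNorm r (m + 1) (h i j) ≤ truncNorm (2 * r) (m + 1) (f i j - linPart (f i j)) :=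
            truncNorm_succ_subst_le hr0.le hΨ.constant hΨm (by positivity) h2
        _ ≤ (2 * r / ρ) ^ 2 * truncNorm ρ (m + 1) (f i j - linPart (f i j)) :=
            truncNorm_le_sq_mul (by positivity) hρ (by linarith) h2
        _ ≤ (2 * r / ρ) ^ 2 * K :=
            mul_le_mul_of_nonneg_left ((truncNorm_sub_linPart_le hρ.le _).trans (hK i j _))
              (by positivity)
        _ = H := by rw [hH]; ring
    refine ⟨hHb, fun i j => ?_⟩
    -- The terms of `heq` in `M i j` and in `φ j` have disjoint supports, resonant and nonresonant,
    -- so the former is bounded coefficientwise by `h i j`.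
    have h3 : truncNorm r (m + 1) ((M i j - C (μ i j)) * X j) ≤ truncNorm r (m + 1) (h i j) := by
      refine truncNorm_le_truncNorm hr0.le fun Q _ => ?_
      by_cases hQ : coeff Q ((M i j - C (μ i j)) * X j) = 0
      · rw [hQ, norm_zero]; exact norm_nonneg _
      · have hw : Homog (eigenWeight μ) (1 * eigenWeight μ j) ((M i j - C (μ i j)) * X j) :=
          ((hM.homog i j).sub (Homog.C _)).mul (Homog.X j)
        rw [one_mul] at hw
        have hφQ : coeff Q (φ j) = 0 := by
          by_contra hne
          exact hφres j Q hne (hw Q hQ)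
        have hsQ : coeff Q (subst (fun k => M i k * X k) (φ j)) = 0 := by
          by_contra hne
          obtain ⟨R, hR, hRQ⟩ := exists_multiPow_eq_of_coeff_subst_ne_zero
            (by simp) (hM.homog_mul_X i) hne
          exact hφres j R hR (hRQ.trans (hw Q hQ))
        rw [heq, map_add, map_sub, coeff_C_mul, hφQ, hsQ, mul_zero, sub_zero, add_zero]
    have h4 := (mul_truncNorm_le_truncNorm_mul_X (m := m) (S := M i j - C (μ i j)) hr0.le j).trans
      (h3.trans (hHb i j))
    have h5 : r * truncNorm r m (M i j - C (μ i j)) ≤ r * (K * (2 / ρ) ^ 2 * r) := by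
      rw [hH] at h4
      linarith
    exact (le_of_mul_le_mul_left h5 hr0).trans (hrμ i j)
  have hbound : ∀ m j, truncNorm r m (φ j) ≤ r := by
    intro m
    induction m with
    | zero =>
      intro j
      refine le_of_eq_of_le (Finset.sum_eq_zero fun Q hQ => ?_) hr0.le
      rw [hφ2 j Q (by have := mem_multiIndicesLE.1 hQ; omega), norm_zero, zero_mul]
    | succ m ih =>
      intro j
      obtain ⟨hHb, hMb⟩ := hstep m ih
      obtain ⟨s, hs⟩ := exists_truncNorm_eq_sum_restrict (multiPow (multiplierWeight M)) r (m + 1)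
      -- The good index `i` depends on the class. Summing over all `i` removes this dependence at
      -- the cost of the factor `l`.
      have hclass : ∀ v, b * truncNorm r (m + 1)
          (restrict {Q | multiPow (multiplierWeight M) Q = v} (φ j)) ≤
          ∑ i, truncNorm r (m + 1)
            (restrict {Q | multiPow (multiplierWeight M) Q = v} (h i j)) := by
        intro v
        have hnn : ∀ i, 0 ≤ truncNorm r (m + 1)
            (restrict {Q | multiPow (multiplierWeight M) Q = v} (h i j)) :=
          fun i => truncNorm_nonneg hr0.le
        by_cases hex : ∃ Q, multiPow (multiplierWeight M) Q = v ∧ coeff Q (φ j) ≠ 0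
        · obtain ⟨Q, rfl, hQ⟩ := hex
          have hQw := hφres j Q hQ
          obtain ⟨i, Q', hw, hcmp, hb⟩ := hgap j Q hQw
          set A := {P : Fin n →₀ ℕ |
            multiPow (multiplierWeight M) P = multiPow (multiplierWeight M) Q} with hA
          have hS0 : constantCoeff (restrict A (φ j)) = 0 := by
            have h0 := hφ0 j
            rw [← coeff_zero_eq_constantCoeff_apply] at h0 ⊢
            rw [coeff_restrict, h0, ite_self]
          -- The lower bound holds for the exponent `Q'`, the homological equation for `Q`; the two
          -- multipliers coincide.
          have h6 := le_truncNorm_multiPow_sub_mul hr0.le hδ0.le hδ1 (hMb i) hb hS0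
          rw [hM.multiPow_eq hμ hw hcmp, multiplier_mul_restrict hμ hM i j (heq i j) hQw] at h6
          exact h6.trans (Finset.single_le_sum (f := fun i => truncNorm r (m + 1)
            (restrict A (h i j))) (fun i _ => hnn i) (Finset.mem_univ i))
        · have h0 : restrict {Q | multiPow (multiplierWeight M) Q = v} (φ j) = 0 := by
            ext Q
            by_cases hQ : Q ∈ {Q | multiPow (multiplierWeight M) Q = v}
            · rw [coeff_restrict_of_mem _ hQ, map_zero]
              by_contra hne
              exact hex ⟨Q, hQ, hne⟩
            · rw [coeff_restrict_of_notMem _ hQ, map_zero]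
          rw [h0, truncNorm_zero, mul_zero]
          exact Finset.sum_nonneg fun i _ => hnn i
      have h7 : b * truncNorm r (m + 1) (φ j) ≤ b * r := by
        calc b * truncNorm r (m + 1) (φ j)
            ≤ ∑ v ∈ s, ∑ i, truncNorm r (m + 1)
                (restrict {Q | multiPow (multiplierWeight M) Q = v} (h i j)) := by
              rw [hs, Finset.mul_sum]
              exact Finset.sum_le_sum fun v _ => hclass v
          _ = ∑ i, truncNorm r (m + 1) (h i j) := by
              rw [Finset.sum_comm]
              exact Finset.sum_congr rfl fun i _ => (hs _).symm
          _ ≤ ∑ _i : Fin l, H := Finset.sum_le_sum fun i _ => hHb i j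
          _ = l * (K * (2 / ρ) ^ 2) * r * r := by
              rw [Finset.sum_const, Finset.card_univ, Fintype.card_fin, nsmul_eq_mul, hH]
              ring
          _ ≤ b * r := mul_le_mul_of_nonneg_right hrb hr0.le
      exact le_of_mul_le_mul_left h7 hb0
  refine ⟨r, hr0, fun m j => ?_, fun m i j => ?_⟩
  · have h1 := truncNorm_le_add_sub (S := Ψ j) (T := X j) (m := m) hr0.le
    have h2 := truncNorm_X_le (n := n) (m := m) hr0.le j
    have h3 := hbound m j
    simp only [hφ] at h3
    linarith
  · have h1 := truncNorm_le_add_sub (S := M i j) (T := C (μ i j)) (m := m) hr0.le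
    have h2 := (hstep m (hbound m)).2 i j
    have h3 : truncNorm r m (C (μ i j) : MvPowerSeries (Fin n) ℂ) ≤ ‖μ i j‖ := by
      have := truncNorm_C_mul (r := r) (m := m) (S := (1 : MvPowerSeries (Fin n) ℂ)) (μ i j)
      rw [mul_one] at this
      rw [this]
      exact mul_le_of_le_one_right (norm_nonneg _) (truncNorm_one_le hr0.le)
    have h4 : ‖μ i j‖ * δ ≤ ‖μ i j‖ := mul_le_of_le_one_right (norm_nonneg _) hδ1
    linarith

end Estimate

/-! ### Convergent power series: products, composition, analyticity. -/

section Convergence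

open MvPowerSeries

variable {n : ℕ}

namespace MvPowerSeries

theorem hasSum_mul_of_summable_norm {ι κ : Type*} {a : ι → ℂ} {b : κ → ℂ} {u v : ℂ}
    (hu : HasSum a u) (hv : HasSum b v) (ha : Summable fun i => ‖a i‖)
    (hb : Summable fun i => ‖b i‖) : HasSum (fun z : ι × κ => a z.1 * b z.2) (u * v) := by
  have h := summable_mul_of_summable_norm ha hb
  exact hu.mul hv h

/-- Absolute convergence on the closed polydisc of radius `r`. -/
def AbsSummable (r : ℝ) (S : MvPowerSeries (Fin n) ℂ) : Prop :=
  Summable fun Q : Fin n →₀ ℕ => ‖coeff Q S‖ * r ^ Q.degree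

theorem norm_multiPow_le {x : Fin n → ℂ} {r : ℝ} (hx : ∀ k, ‖x k‖ ≤ r)
    (Q : Fin n →₀ ℕ) : ‖multiPow x Q‖ ≤ r ^ Q.degree := by
  induction Q using multiIndex_induction with
  | h0 => simp [multiPow_zero]
  | hs k P ih =>
    rw [multiPow_add, multiPow_single_one, map_add, Finsupp.degree_single, pow_add, pow_one,
      norm_mul]
    exact mul_le_mul (hx k) ih (norm_nonneg _) ((norm_nonneg _).trans (hx k))

theorem multiPow_const {W : Type*} [CommMonoid W] (r : W) (Q : Fin n →₀ ℕ) :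
    multiPow (fun _ => r) Q = r ^ Q.degree := by
  rw [multiPow, Finset.prod_pow_eq_pow_sum, Finsupp.degree_eq_sum]

theorem multiPow_zero_left (Q : Fin n →₀ ℕ) (hQ : Q ≠ 0) : multiPow (0 : Fin n → ℂ) Q = 0 := by
  obtain ⟨k, P, rfl⟩ := exists_eq_single_add hQ
  rw [multiPow_add, multiPow_single_one, Pi.zero_apply, zero_mul]

theorem sum_le_of_truncNorm_le {r B : ℝ} (hr : 0 ≤ r) {S : MvPowerSeries (Fin n) ℂ}
    (h : ∀ m, truncNorm r m S ≤ B) (u : Finset (Fin n →₀ ℕ)) :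
    ∑ Q ∈ u, ‖coeff Q S‖ * r ^ Q.degree ≤ B := by
  refine (Finset.sum_le_sum_of_subset_of_nonneg (t := multiIndicesLE n (u.sup fun Q => Q.degree))
    (fun Q hQ => ?_) fun _ _ _ => by positivity).trans (h _)
  exact mem_multiIndicesLE.2 (Finset.le_sup (f := fun Q : Fin n →₀ ℕ => Q.degree) hQ)

namespace AbsSummable

variable {r : ℝ} {S T : MvPowerSeries (Fin n) ℂ} {x : Fin n → ℂ}

theorem of_truncNorm_le {B : ℝ} (hr : 0 ≤ r) (h : ∀ m, truncNorm r m S ≤ B) : AbsSummable r S :=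
  summable_of_sum_le (fun _ => by positivity) (sum_le_of_truncNorm_le hr h)

theorem truncNorm_le (hr : 0 ≤ r) (hS : AbsSummable r S) (m : ℕ) :
    truncNorm r m S ≤ ∑' Q : Fin n →₀ ℕ, ‖coeff Q S‖ * r ^ Q.degree :=
  hS.sum_le_tsum _ fun _ _ => by positivity

theorem mono {r' : ℝ} (hr : 0 ≤ r') (h : r' ≤ r) (hS : AbsSummable r S) : AbsSummable r' S :=
  Summable.of_nonneg_of_le (fun _ => by positivity) (fun Q => by gcongr) hS

theorem mul (hr : 0 ≤ r) (hS : AbsSummable r S) (hT : AbsSummable r T) : AbsSummable r (S * T) :=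
  of_truncNorm_le hr fun m => (truncNorm_mul_le hr).trans
    (mul_le_mul (hS.truncNorm_le hr m) (hT.truncNorm_le hr m) (truncNorm_nonneg hr)
      (tsum_nonneg fun _ => by positivity))

theorem summable_norm (hS : AbsSummable r S) (hx : ∀ k, ‖x k‖ ≤ r) :
    Summable fun Q : Fin n →₀ ℕ => ‖coeff Q S * multiPow x Q‖ :=
  Summable.of_nonneg_of_le (fun _ => norm_nonneg _) (fun Q => by
    rw [norm_mul]
    exact mul_le_mul_of_nonneg_left (norm_multiPow_le hx Q) (norm_nonneg _)) hS

theorem hasSum_mul (hS : AbsSummable r S) (hT : AbsSummable r T) (hx : ∀ k, ‖x k‖ ≤ r) {u v : ℂ}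
    (hu : HasSum (fun Q : Fin n →₀ ℕ => coeff Q S * multiPow x Q) u)
    (hv : HasSum (fun Q : Fin n →₀ ℕ => coeff Q T * multiPow x Q) v) :
    HasSum (fun Q : Fin n →₀ ℕ => coeff Q (S * T) * multiPow x Q) (u * v) := by
  have h1 := hasSum_mul_of_summable_norm hu hv (hS.summable_norm hx) (hT.summable_norm hx)
  have h2 := (Finset.HasAntidiagonal.sigmaAntidiagonalEquivProd (A := Fin n →₀ ℕ)).hasSum_iff.2 h1
  refine h2.sigma fun Q => ?_
  have e : coeff Q (S * T) * multiPow x Q =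
      ∑ p : Finset.HasAntidiagonal.antidiagonal Q,
        coeff p.1.1 S * multiPow x p.1.1 * (coeff p.1.2 T * multiPow x p.1.2) := by
    rw [coeff_mul, Finset.sum_mul, ← Finset.sum_coe_sort]
    refine Finset.sum_congr rfl fun p _ => ?_
    have hp := Finset.HasAntidiagonal.mem_antidiagonal.1 p.2
    rw [← congrArg (multiPow x) hp, multiPow_add]
    ring
  rw [e]
  exact hasSum_fintype _

theorem hasSum_multiPow (hr : 0 ≤ r) {q : Fin n → MvPowerSeries (Fin n) ℂ}
    (hq : ∀ k, AbsSummable r (q k)) (hx : ∀ k, ‖x k‖ ≤ r) {u : Fin n → ℂ}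
    (hu : ∀ k, HasSum (fun Q : Fin n →₀ ℕ => coeff Q (q k) * multiPow x Q) (u k))
    (R : Fin n →₀ ℕ) :
    AbsSummable r (multiPow q R) ∧
      HasSum (fun Q : Fin n →₀ ℕ => coeff Q (multiPow q R) * multiPow x Q) (multiPow u R) := by
  induction R using multiIndex_induction with
  | h0 =>
    simp only [multiPow_zero]
    refine ⟨of_truncNorm_le hr fun m => truncNorm_one_le hr, ?_⟩
    have := hasSum_ite_eq (0 : Fin n →₀ ℕ) (1 : ℂ)
    convert! this using 2 with Q
    rw [coeff_one]
    split_ifs with h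
    · rw [h, multiPow_zero, one_mul]
    · rw [zero_mul]
  | hs k P ih =>
    simp only [multiPow_add, multiPow_single_one]
    exact ⟨(hq k).mul hr ih.1, (hq k).hasSum_mul ih.1 hx (hu k) ih.2⟩

/-- Composition of absolutely convergent power series. -/
theorem hasSum_subst {s : ℝ} (hr : 0 ≤ r) (hs : 0 ≤ s) {p : MvPowerSeries (Fin n) ℂ}
    (hp : AbsSummable s p) {q : Fin n → MvPowerSeries (Fin n) ℂ}
    (hq0 : ∀ k, constantCoeff (q k) = 0) (hq : ∀ k m, truncNorm r m (q k) ≤ s)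
    (hx : ∀ k, ‖x k‖ ≤ r) {u : Fin n → ℂ} {v : ℂ}
    (hu : ∀ k, HasSum (fun Q : Fin n →₀ ℕ => coeff Q (q k) * multiPow x Q) (u k))
    (hv : HasSum (fun Q : Fin n →₀ ℕ => coeff Q p * multiPow u Q) v) :
    HasSum (fun P : Fin n →₀ ℕ => coeff P (subst q p) * multiPow x P) v := by
  have hqa : ∀ k, AbsSummable r (q k) := fun k => of_truncNorm_le hr (hq k)
  have hpow := hasSum_multiPow hr hqa hx hu
  set F : (Fin n →₀ ℕ) × (Fin n →₀ ℕ) → ℂ := fun z =>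
    coeff z.1 p * (coeff z.2 (multiPow q z.1) * multiPow x z.2) with hF
  -- Absolute summability of the double series justifies summing first over the monomials of `p` or
  -- first over those of `x`.
  have hFs : Summable F := by
    refine Summable.of_norm ((summable_prod_of_nonneg fun _ => norm_nonneg _).2 ⟨fun Q => ?_, ?_⟩)
    · simp only [hF, norm_mul (coeff Q p)]
      exact ((hpow Q).1.summable_norm hx).mul_left _
    · refine Summable.of_nonneg_of_le (fun _ => tsum_nonneg fun _ => norm_nonneg _)
        (fun Q => ?_) hp
      simp only [hF, norm_mul (coeff Q p)]
      rw [tsum_mul_left]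
      refine mul_le_mul_of_nonneg_left ?_ (norm_nonneg _)
      refine Real.tsum_le_of_sum_le (fun _ => norm_nonneg _) fun t => ?_
      refine (Finset.sum_le_sum fun P _ => ?_).trans (sum_le_of_truncNorm_le hr
        (fun m => truncNorm_multiPow_le hr (fun k => hq k m) hs Q) t)
      rw [norm_mul]
      exact mul_le_mul_of_nonneg_left (norm_multiPow_le hx P) (norm_nonneg _)
  have h1 : HasSum F v := by
    have h2 := hFs.hasSum.prod_fiberwise fun Q => (hpow Q).2.mul_left (coeff Q p)
    rw [hv.unique h2]
    exact hFs.hasSum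
  have h3 := ((Equiv.prodComm (Fin n →₀ ℕ) (Fin n →₀ ℕ)).hasSum_iff (f := F)).2 h1
  refine h3.prod_fiberwise fun P => ?_
  rw [coeff_subst_eq_sum hq0 p le_rfl, Finset.sum_mul]
  have h4 : ∀ Q ∉ multiIndicesLE n P.degree,
      coeff Q p * (coeff P (multiPow q Q) * multiPow x P) = 0 := fun Q hQ => by
    rw [mem_multiIndicesLE, not_le] at hQ
    rw [vanishesBelow_multiPow hq0 Q P hQ, zero_mul, mul_zero]
  simp only [mul_assoc]
  exact hasSum_sum_of_ne_finset_zero h4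

end AbsSummable

end MvPowerSeries

variable {f g : (Fin n → ℂ) → ℂ} {p q : MvPowerSeries (Fin n) ℂ}

theorem eventually_norm_le {r : ℝ} (hr : 0 < r) :
    ∀ᶠ x : Fin n → ℂ in 𝓝 0, ∀ k, ‖x k‖ ≤ r := by
  filter_upwards [Metric.closedBall_mem_nhds (0 : Fin n → ℂ) hr] with x hx k
  exact (norm_le_pi_norm x k).trans (mem_closedBall_zero_iff.1 hx)

theorem MvPowerSeries.AbsSummable.hasTaylor {r : ℝ} (hr : 0 < r) (hp : AbsSummable r p) :
    HasTaylor (fun x => ∑' Q : Fin n →₀ ℕ, coeff Q p * multiPow x Q) p := by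
  filter_upwards [eventually_norm_le hr] with x hx
  exact (hp.summable_norm hx).of_norm.hasSum

/-- Unconditional convergence in `ℂ` is absolute, so it suffices to evaluate at the point with all
coordinates `ε / 2`. -/
theorem HasTaylor.exists_absSummable (h : HasTaylor f p) : ∃ r > 0, AbsSummable r p := by
  obtain ⟨ε, hε, hball⟩ := Metric.eventually_nhds_iff.1 h
  have hx : dist (fun _ : Fin n => ((ε / 2 : ℝ) : ℂ)) 0 < ε := by
    rw [dist_pi_lt_iff hε]
    intro k
    rw [Pi.zero_apply, dist_zero_right, Complex.norm_real, Real.norm_of_nonneg (by positivity)]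
    linarith
  refine ⟨ε / 2, by positivity, ?_⟩
  have hs := (hball hx).summable.norm
  change Summable fun Q : Fin n →₀ ℕ => ‖coeff Q p * multiPow (fun _ => ((ε / 2 : ℝ) : ℂ)) Q‖ at hs
  have hε2 : ‖((ε / 2 : ℝ) : ℂ)‖ = ε / 2 := by
    rw [Complex.norm_real, Real.norm_of_nonneg (by positivity)]
  simp only [multiPow_const, norm_mul, norm_pow, hε2] at hs
  exact hs

theorem HasTaylor.eventually_eq (hf : HasTaylor f p) (hg : HasTaylor g p) : f =ᶠ[𝓝 0] g := by
  filter_upwards [hf, hg] with x h1 h2 using h1.unique h2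

theorem HasTaylor.apply_zero (hf : HasTaylor f p) : f 0 = constantCoeff p := by
  have h1 := hf.self_of_nhds
  refine h1.unique ?_
  rw [← coeff_zero_eq_constantCoeff_apply]
  have h2 := hasSum_single (f := fun Q : Fin n →₀ ℕ => coeff Q p * multiPow (0 : Fin n → ℂ) Q) 0
    fun Q hQ => by rw [multiPow_zero_left Q hQ, mul_zero]
  rw [multiPow_zero, mul_one] at h2
  exact h2

theorem hasTaylor_monomial (P : Fin n →₀ ℕ) (c : ℂ) :
    HasTaylor (fun x => c * multiPow x P) (monomial P c) := by
  refine Eventually.of_forall fun x => ?_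
  have := hasSum_ite_eq P (c * multiPow x P)
  convert! this using 2 with Q
  rw [coeff_monomial]
  split_ifs with h
  · rw [h]; rfl
  · rw [zero_mul]

theorem HasTaylor.mul (hf : HasTaylor f p) (hg : HasTaylor g q) :
    HasTaylor (fun x => f x * g x) (p * q) := by
  obtain ⟨r, hr, hp⟩ := hf.exists_absSummable
  obtain ⟨r', hr', hq⟩ := hg.exists_absSummable
  have h0 : 0 < min r r' := lt_min hr hr'
  filter_upwards [hf, hg, eventually_norm_le h0] with x hfx hgx hx
  exact (hp.mono h0.le (min_le_left _ _)).hasSum_mul (hq.mono h0.le (min_le_right _ _)) hx hfx hgx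

theorem hasTaylor_multiPow {g : Fin n → (Fin n → ℂ) → ℂ} {q : Fin n → MvPowerSeries (Fin n) ℂ}
    (hg : ∀ k, HasTaylor (g k) (q k)) (Q : Fin n →₀ ℕ) :
    HasTaylor (fun x => multiPow (fun k => g k x) Q) (multiPow q Q) := by
  induction Q using multiIndex_induction with
  | h0 => simpa [multiPow_zero, monomial_zero_one] using hasTaylor_monomial (0 : Fin n →₀ ℕ) 1
  | hs k P ih =>
    simp only [multiPow_add, multiPow_single_one]
    exact (hg k).mul ih

theorem hasTaylor_mul_apply (hf : HasTaylor f p) (k : Fin n) :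
    HasTaylor (fun x => f x * x k) (p * X k) := by
  have := hasTaylor_monomial (Finsupp.single k 1 : Fin n →₀ ℕ) 1
  simp only [multiPow_single_one, one_mul] at this
  exact hf.mul this

theorem hasTaylor_diag (a : Fin n → ℂ) (k : Fin n) :
    HasTaylor (fun x => (a * x) k) (FormalMap.diag a k) := by
  have := hasTaylor_mul_apply (hasTaylor_monomial (0 : Fin n →₀ ℕ) (a k)) k
  simpa [multiPow_zero, FormalMap.diag] using this

/-- Monomials as continuous multilinear maps. -/
theorem exists_multilinear_multiPow (m : ℕ) (Q : Fin n →₀ ℕ) :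
    ∃ T : ContinuousMultilinearMap ℂ (fun _ : Fin m => Fin n → ℂ) ℂ, ‖T‖ ≤ 1 ∧
      (Q.degree = m → ∀ x, T (fun _ => x) = multiPow x Q) := by
  by_cases hQ : Q.degree = m
  · have henum : ∀ (m : ℕ) (Q : Fin n →₀ ℕ), Q.degree = m →
        ∃ s : Fin m → Fin n, ∀ x : Fin n → ℂ, ∏ i, x (s i) = multiPow x Q := by
      intro m
      induction m with
      | zero =>
        intro Q hQ
        rw [(Finsupp.degree_eq_zero_iff Q).1 hQ]
        exact ⟨Fin.elim0, fun x => by simp [multiPow_zero]⟩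
      | succ m ih =>
        intro Q hQ
        have hQ0 : Q ≠ 0 := by rintro rfl; simp at hQ
        obtain ⟨k, P, rfl⟩ := exists_eq_single_add hQ0
        rw [map_add, Finsupp.degree_single] at hQ
        obtain ⟨s, hs⟩ := ih P (by omega)
        refine ⟨Fin.cons k s, fun x => ?_⟩
        rw [Fin.prod_univ_succ, multiPow_add, multiPow_single_one, ← hs]
        simp
    obtain ⟨s, hs⟩ := henum m Q hQ
    refine ⟨(ContinuousMultilinearMap.mkPiAlgebra ℂ (Fin m) ℂ).compContinuousLinearMap
      fun i => ContinuousLinearMap.proj (s i), ?_, fun _ x => ?_⟩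
    · refine ContinuousMultilinearMap.opNorm_le_bound zero_le_one fun v => ?_
      rw [one_mul, ContinuousMultilinearMap.compContinuousLinearMap_apply,
        ContinuousMultilinearMap.mkPiAlgebra_apply, norm_prod]
      exact Finset.prod_le_prod (fun _ _ => norm_nonneg _) fun i _ => norm_le_pi_norm (v i) (s i)
    · rw [ContinuousMultilinearMap.compContinuousLinearMap_apply,
        ContinuousMultilinearMap.mkPiAlgebra_apply, ← hs]
      rfl
  -- In the wrong degree the value is `0`, so that a multilinear map can be chosen for all pairs
  -- `(m, Q)`.
  · exact ⟨0, by simp, fun h => absurd h hQ⟩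

/-- Grouping the monomials by degree gives a series of multilinear maps; its degree 1 term is
recorded because it is the derivative. -/
theorem HasTaylor.exists_hasFPowerSeriesAt (hf : HasTaylor f p) :
    ∃ P : FormalMultilinearSeries ℂ (Fin n → ℂ) ℂ, HasFPowerSeriesAt f P 0 ∧
      ∀ x, P 1 (fun _ => x) = ∑ k, coeff (Finsupp.single k 1) p * x k := by
  classical
  choose T hT1 hT using fun m => exists_multilinear_multiPow (n := n) m
  set I : ℕ → Finset (Fin n →₀ ℕ) := fun m => (Finsupp.finite_of_degree_eq (σ := Fin n) m).toFinset
    with hI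
  have hmem : ∀ m Q, Q ∈ I m ↔ Q.degree = m := fun m Q => by simp [hI]
  set P : FormalMultilinearSeries ℂ (Fin n → ℂ) ℂ := fun m => ∑ Q ∈ I m, coeff Q p • T m Q with hPdef
  have hPx : ∀ m x, P m (fun _ => x) = ∑ Q ∈ I m, coeff Q p * multiPow x Q := by
    intro m x
    rw [hPdef, _root_.sum_apply]
    refine Finset.sum_congr rfl fun Q hQ => ?_
    rw [_root_.smul_apply, hT m Q ((hmem m Q).1 hQ), smul_eq_mul]
  obtain ⟨r, hr, hp⟩ := hf.exists_absSummable
  lift r to NNReal using hr.le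
  have hrad : (r : ENNReal) ≤ P.radius := by
    refine P.le_radius_of_bound (∑' Q : Fin n →₀ ℕ, ‖coeff Q p‖ * r ^ Q.degree) fun m => ?_
    refine le_trans ?_ (hp.sum_le_tsum (I m) fun _ _ => by positivity)
    calc ‖P m‖ * r ^ m ≤ (∑ Q ∈ I m, ‖coeff Q p‖) * r ^ m := by
          refine mul_le_mul_of_nonneg_right ((norm_sum_le _ _).trans
            (Finset.sum_le_sum fun Q _ => ?_)) (by positivity)
          rw [norm_smul]
          exact mul_le_of_le_one_right (norm_nonneg _) (hT1 m Q)
      _ = ∑ Q ∈ I m, ‖coeff Q p‖ * r ^ Q.degree := by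
          rw [Finset.sum_mul]
          exact Finset.sum_congr rfl fun Q hQ => by rw [(hmem m Q).1 hQ]
  have hball : HasFPowerSeriesOnBall
      (fun x => ∑' Q : Fin n →₀ ℕ, coeff Q p * multiPow x Q) P 0 r := by
    refine ⟨hrad, ENNReal.coe_pos.2 (NNReal.coe_pos.1 hr), fun {y} hy => ?_⟩
    have hy' : ∀ k, ‖y k‖ ≤ r := fun k => by
      rw [Metric.eball_coe, mem_ball_zero_iff] at hy
      exact (norm_le_pi_norm y k).trans hy.le
    have h1 := (hp.summable_norm hy').of_norm.hasSum.tsum_fiberwise fun Q => Q.degree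
    rw [zero_add]
    convert! h1 using 2 with m
    have hset : (fun Q : Fin n →₀ ℕ => Q.degree) ⁻¹' {m} = ↑(I m) := by
      ext Q
      simp [hmem]
    rw [hPx, hset]
    exact (Finset.tsum_subtype (I m) fun Q => coeff Q p * multiPow y Q).symm
  refine ⟨P, hball.hasFPowerSeriesAt.congr ((hp.hasTaylor hr).eventually_eq hf), fun x => ?_⟩
  have himg : I 1 = Finset.univ.image fun k : Fin n => (Finsupp.single k 1 : Fin n →₀ ℕ) := by
    ext Q
    rw [hmem, Finset.mem_image]
    constructor
    · intro h
      obtain ⟨k, rfl⟩ := exists_eq_single_of_degree_eq_one h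
      exact ⟨k, Finset.mem_univ _, rfl⟩
    · rintro ⟨k, -, rfl⟩
      exact Finsupp.degree_single k 1
  rw [hPx, himg, Finset.sum_image fun a _ b _ h => (Finsupp.single_left_inj one_ne_zero).1 h]
  simp only [multiPow_single_one]

theorem HasTaylor.analyticAt (hf : HasTaylor f p) : AnalyticAt ℂ f 0 := by
  obtain ⟨P, hP, -⟩ := hf.exists_hasFPowerSeriesAt
  exact hP.analyticAt

theorem HasTaylor.exists_hasFDerivAt (hf : HasTaylor f p) :
    ∃ L : (Fin n → ℂ) →L[ℂ] ℂ, HasFDerivAt f L 0 ∧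
      ∀ x, L x = ∑ k, coeff (Finsupp.single k 1) p * x k := by
  obtain ⟨P, hP, h1⟩ := hf.exists_hasFPowerSeriesAt
  refine ⟨_, hP.hasFDerivAt, fun x => ?_⟩
  rw [continuousMultilinearCurryFin1_apply, ← h1]
  congr 1

/-- Expanding `P m (x, …, x)` over the basis gives one term for each word of length `m` in the `n`
coordinates; the coefficient of `x ^ Q` collects the words with content `Q`. -/
theorem AnalyticAt.exists_hasTaylor (hf : AnalyticAt ℂ f 0) : ∃ p, HasTaylor f p := by
  classical
  obtain ⟨P, R, hP⟩ := hf
  set c : (Σ m : ℕ, Fin m → Fin n) → ℂ := fun z => P z.1 fun i => Pi.single (z.2 i) 1 with hc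
  set content : (Σ m : ℕ, Fin m → Fin n) → (Fin n →₀ ℕ) := fun z =>
    ∑ i, Finsupp.single (z.2 i) 1 with hcontent
  have hcx : ∀ (x : Fin n → ℂ) z, multiPow x (content z) = ∏ i, x (z.2 i) := by
    intro x z
    have h : ∀ (t : Finset (Fin z.1)),
        multiPow x (∑ i ∈ t, Finsupp.single (z.2 i) 1) = ∏ i ∈ t, x (z.2 i) := by
      intro t
      induction t using Finset.induction_on with
      | empty => simp [multiPow_zero]
      | insert a t ha ih =>
        rw [Finset.sum_insert ha, Finset.prod_insert ha, multiPow_add, multiPow_single_one, ih]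
    exact h Finset.univ
  refine ⟨fun Q => ∑' z : content ⁻¹' {Q}, c z, ?_⟩
  obtain ⟨r, hr0, hrR⟩ := ENNReal.lt_iff_exists_nnreal_btwn.1 hP.r_pos
  have hr0' : (0 : ℝ) < r := by exact_mod_cast hr0
  have hn : (0 : ℝ) < n + 1 := by positivity
  -- There are `n ^ m` words of length `m`, so absolute convergence is obtained on a ball smaller by
  -- the factor `n + 1`, which unlike `n` is never zero.
  filter_upwards [Metric.ball_mem_nhds (0 : Fin n → ℂ) (div_pos hr0' hn)] with x hx
  rw [mem_ball_zero_iff] at hx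
  have hnx : (n + 1) * ‖x‖ ≤ r := by
    rw [lt_div_iff₀ hn] at hx
    linarith
  have hxr : ‖x‖ < r := hx.trans_le (div_le_self hr0'.le (by linarith [n.cast_nonneg (α := ℝ)]))
  have hxball : x ∈ Metric.eball (0 : Fin n → ℂ) R := by
    refine Metric.eball_subset_eball hrR.le ?_
    rw [Metric.eball_coe, mem_ball_zero_iff]
    exact hxr
  have hexp : ∀ m, P m (fun _ => x) = ∑ s : Fin m → Fin n, c ⟨m, s⟩ * multiPow x (content ⟨m, s⟩) := by
    intro m
    have hx' : (fun _ : Fin m => x) = fun _ => ∑ k, x k • (Pi.single k 1 : Fin n → ℂ) := by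
      funext i
      exact pi_eq_sum_univ' x |>.trans (by
        refine Finset.sum_congr rfl fun k _ => ?_
        congr 1)
    rw [hx', ContinuousMultilinearMap.map_sum]
    refine Finset.sum_congr rfl fun s _ => ?_
    rw [hcx, ContinuousMultilinearMap.map_smul_univ, smul_eq_mul, mul_comm]
  have hsum : Summable fun z => c z * multiPow x (content z) := by
    refine Summable.of_norm ((summable_sigma_of_nonneg fun _ => norm_nonneg _).2
      ⟨fun m => Summable.of_finite, ?_⟩)
    have h1 := P.summable_norm_mul_pow (r := r) (hrR.trans_le hP.r_le)
    refine Summable.of_nonneg_of_le (fun _ => tsum_nonneg fun _ => norm_nonneg _) (fun m => ?_) h1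
    rw [tsum_fintype]
    have h2 : ∀ s : Fin m → Fin n, ‖c ⟨m, s⟩ * multiPow x (content ⟨m, s⟩)‖ ≤ ‖P m‖ * ‖x‖ ^ m := by
      intro s
      rw [norm_mul, hcx]
      refine mul_le_mul ?_ ?_ (norm_nonneg _) (norm_nonneg _)
      · refine ((P m).le_opNorm _).trans (mul_le_of_le_one_right (norm_nonneg _) ?_)
        refine Finset.prod_le_one (fun _ _ => norm_nonneg _) fun i _ => ?_
        rw [pi_norm_le_iff_of_nonneg zero_le_one]
        intro k
        rw [Pi.single_apply]
        split_ifs <;> simp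
      · rw [norm_prod]
        refine (Finset.prod_le_prod (fun _ _ => norm_nonneg _)
          fun i _ => norm_le_pi_norm x (s i)).trans ?_
        simp
    refine (Finset.sum_le_sum fun s _ => h2 s).trans ?_
    rw [Finset.sum_const, Finset.card_univ, Fintype.card_fun, Fintype.card_fin, Fintype.card_fin,
      nsmul_eq_mul]
    calc ((n ^ m : ℕ) : ℝ) * (‖P m‖ * ‖x‖ ^ m) = ‖P m‖ * (n * ‖x‖) ^ m := by
          push_cast; rw [mul_pow]; ring
      _ ≤ ‖P m‖ * r ^ m := by
          refine mul_le_mul_of_nonneg_left (pow_le_pow_left₀ (by positivity) ?_ m) (norm_nonneg _)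
          linarith [norm_nonneg x]
  have hfx : HasSum (fun z => c z * multiPow x (content z)) (f x) := by
    have h1 := hP.hasSum hxball
    rw [zero_add] at h1
    have h2 := hsum.hasSum.sigma fun m => hasSum_fintype _
    simp only [hexp] at h1
    rw [h1.unique h2]
    exact hsum.hasSum
  have h3 := hfx.tsum_fiberwise content
  change HasSum (fun Q : Fin n →₀ ℕ => (∑' z : content ⁻¹' {Q}, c z) * multiPow x Q) (f x)
  convert! h3 using 2 with Q
  rw [← tsum_mul_right]
  refine tsum_congr fun z => ?_
  rw [show content z = Q from z.2]

/-- The Taylor expansion of a composition. -/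
theorem HasTaylor.comp (hf : HasTaylor f p) {g : (Fin n → ℂ) → Fin n → ℂ}
    {q : Fin n → MvPowerSeries (Fin n) ℂ} (hg : ∀ k, HasTaylor (fun x => g x k) (q k))
    (hq0 : ∀ k, constantCoeff (q k) = 0) : HasTaylor (fun x => f (g x)) (subst q p) := by
  obtain ⟨s, hs, hp⟩ := hf.exists_absSummable
  choose ρ hρ hq using fun k => (hg k).exists_absSummable
  set B : Fin n → ℝ := fun k => ∑' Q : Fin n →₀ ℕ, ‖coeff Q (q k)‖ * ρ k ^ Q.degree with hB
  -- Since `q k` has no constant term, its norm decreases at least linearly with the radius and can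
  -- be brought below `s`.
  have hr : ∀ᶠ r : ℝ in 𝓝[>] 0, 0 < r ∧ ∀ k, r ≤ ρ k ∧ r / ρ k * B k ≤ s := by
    have hpos : ∀ᶠ r : ℝ in 𝓝[>] 0, 0 < r := eventually_mem_nhdsWithin
    refine hpos.and (eventually_all.2 fun k => Eventually.and ?_ ?_)
    · exact (eventually_le_nhds (hρ k)).filter_mono nhdsWithin_le_nhds
    · have : Tendsto (fun r : ℝ => r / ρ k * B k) (𝓝[>] 0) (𝓝 (0 / ρ k * B k)) :=
        tendsto_nhdsWithin_of_tendsto_nhds (Continuous.tendsto (by fun_prop) 0)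
      exact this.eventually_le_const (by simpa using hs)
  obtain ⟨r, hr0, hrk⟩ := hr.exists
  have hqs : ∀ k m, truncNorm r m (q k) ≤ s := by
    intro k m
    refine le_trans ?_ (hrk k).2
    have h1 : truncNorm r m (q k) ≤ r / ρ k * truncNorm (ρ k) m (q k) := by
      rw [truncNorm, truncNorm, Finset.mul_sum]
      refine Finset.sum_le_sum fun Q _ => ?_
      by_cases hQ : Q = 0
      · rw [hQ, coeff_zero_eq_constantCoeff_apply, hq0]
        simp
      · have hd : Q.degree ≠ 0 := mt (Finsupp.degree_eq_zero_iff Q).1 hQ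
        have h2 : (r / ρ k) ^ Q.degree ≤ r / ρ k :=
          pow_le_of_le_one (div_nonneg hr0.le (hρ k).le) ((div_le_one (hρ k)).2 (hrk k).1) hd
        calc ‖coeff Q (q k)‖ * r ^ Q.degree
            = (r / ρ k) ^ Q.degree * (‖coeff Q (q k)‖ * ρ k ^ Q.degree) := by
              rw [div_pow]
              have := pow_ne_zero Q.degree (hρ k).ne'
              field_simp
          _ ≤ _ := mul_le_mul_of_nonneg_right h2
              (mul_nonneg (norm_nonneg _) (pow_nonneg (hρ k).le _))
    exact h1.trans (mul_le_mul_of_nonneg_left ((hq k).truncNorm_le (hρ k).le m)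
      (div_nonneg hr0.le (hρ k).le))
  have hg0 : g 0 = 0 := funext fun k => by
    rw [Pi.zero_apply, ← hq0 k]
    exact (hg k).apply_zero
  have hcont : Tendsto g (𝓝 0) (𝓝 0) := by
    have : ContinuousAt g 0 := continuousAt_pi.2 fun k => (hg k).analyticAt.continuousAt
    rwa [ContinuousAt, hg0] at this
  filter_upwards [hcont.eventually hf, eventually_all.2 hg, eventually_norm_le hr0] with x h1 h2 h3
  exact hp.hasSum_subst hr0.le hs.le hq0 hqs h3 h2 h1

end Convergence

/-! ### Transfer between germs and their Taylor expansions. -/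

section TaylorMap

open MvPowerSeries

variable {n : ℕ}

theorem hasTaylor_taylorMap {F : (Fin n → ℂ) → Fin n → ℂ} (hF : AnalyticAt ℂ F 0) (j : Fin n) :
    HasTaylor (fun x => F x j) (taylorMap F j) := by
  have h : ∃ p, HasTaylor (fun x => F x j) p :=
    AnalyticAt.exists_hasTaylor (analyticAt_pi_iff.1 hF j)
  rw [taylorMap, dif_pos h]
  exact h.choose_spec

theorem coeff_single_eq_of_hasFDerivAt {f : (Fin n → ℂ) → ℂ} {p : MvPowerSeries (Fin n) ℂ}
    (hf : HasTaylor f p) {L : (Fin n → ℂ) →L[ℂ] ℂ} (hL : HasFDerivAt f L 0) (k : Fin n) :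
    coeff (Finsupp.single k 1) p = L (Pi.single k 1) := by
  obtain ⟨L', hL', h⟩ := hf.exists_hasFDerivAt
  rw [hL.unique hL', h]
  simp [Pi.single_apply]

theorem linearPart_taylorMap {F : (Fin n → ℂ) → Fin n → ℂ} (hF : AnalyticAt ℂ F 0) {a : Fin n → ℂ}
    (hFlin : HasFDerivAt F
      (ContinuousLinearMap.pi fun j => a j • ContinuousLinearMap.proj j :
        (Fin n → ℂ) →L[ℂ] (Fin n → ℂ)) 0) :
    (taylorMap F).linearPart = Matrix.diagonal a := by
  ext j k
  rw [FormalMap.linearPart, Matrix.of_apply,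
    coeff_single_eq_of_hasFDerivAt (hasTaylor_taylorMap hF j) (hasFDerivAt_pi.1 hFlin j) k]
  simp [Matrix.diagonal_apply, Pi.single_apply]

theorem exists_truncNorm_le {ι : Type*} [Finite ι] {f : ι → (Fin n → ℂ) → ℂ}
    {p : ι → MvPowerSeries (Fin n) ℂ} (h : ∀ i, HasTaylor (f i) (p i)) :
    ∃ ρ K : ℝ, 0 < ρ ∧ ∀ i m, truncNorm ρ m (p i) ≤ K := by
  cases nonempty_fintype ι
  choose ρ hρ hp using fun i => (h i).exists_absSummable
  have hpos : ∀ᶠ r : ℝ in 𝓝[>] 0, 0 < r := eventually_mem_nhdsWithin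
  have hr : ∀ᶠ r : ℝ in 𝓝[>] 0, 0 < r ∧ ∀ i, r ≤ ρ i :=
    hpos.and (eventually_all.2 fun i => (eventually_le_nhds (hρ i)).filter_mono nhdsWithin_le_nhds)
  obtain ⟨r, hr0, hr⟩ := hr.exists
  refine ⟨r, ∑ i, ∑' Q : Fin n →₀ ℕ, ‖coeff Q (p i)‖ * r ^ Q.degree, hr0, fun i m => ?_⟩
  refine (((hp i).mono hr0.le (hr i)).truncNorm_le hr0.le m).trans ?_
  exact Finset.single_le_sum
    (f := fun i => ∑' Q : Fin n →₀ ℕ, ‖coeff Q (p i)‖ * r ^ Q.degree)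
    (fun i _ => tsum_nonneg fun _ => by positivity) (Finset.mem_univ i)

theorem hasFDerivAt_id_of_hasTaylor {Φ : (Fin n → ℂ) → Fin n → ℂ} {Ψ : FormalMap n}
    (h : ∀ j, HasTaylor (fun x => Φ x j) (Ψ j)) (hΨ : Ψ.linearPart = 1) :
    HasFDerivAt Φ (ContinuousLinearMap.id ℂ (Fin n → ℂ)) 0 := by
  refine hasFDerivAt_pi'.2 fun j => ?_
  obtain ⟨L, hL, hLx⟩ := (h j).exists_hasFDerivAt
  convert! hL using 1
  ext x
  have : ∀ k, coeff (Finsupp.single k 1) (Ψ j) = (1 : Matrix (Fin n) (Fin n) ℂ) j k := fun k => by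
    rw [← hΨ]; rfl
  simp [hLx, this, Matrix.one_apply]

/-- Germs with the same expansion coincide near `0`, which transfers the formal identities. The
converse half of the resonance condition is read off from the values at `0`. -/
theorem isHolomorphicIntegrableNF_of_hasTaylor {l : ℕ} {μ : Fin l → Fin n → ℂ}
    {M : Fin l → Fin n → MvPowerSeries (Fin n) ℂ} (hM : IsIntegrableMultiplier μ M)
    {m : Fin l → Fin n → (Fin n → ℂ) → ℂ} (h : ∀ i j, HasTaylor (m i j) (M i j)) :
    IsHolomorphicIntegrableNF μ m where
  analytic i j := (h i j).analyticAt
  value i j := by rw [(h i j).apply_zero, hM.value]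
  invariant i j k := by
    have h1 := (h i j).comp (hasTaylor_diag (μ k)) (FormalMap.constantCoeff_diag (μ k))
    rw [homog_one_iff.1 (hM.homog i j) k] at h1
    exact h1.eventually_eq (h i j)
  resonance j Q _ := by
    constructor
    · intro hres i
      have h1 := (hres i).self_of_nhds
      simp only [(h _ _).apply_zero, hM.value] at h1
      exact h1
    · intro hres i
      have h1 := hasTaylor_multiPow (h i) Q
      rw [hM.resonance j Q (isResonant_iff.1 hres) i] at h1
      exact h1.eventually_eq (h i j)

theorem transformsToNF_of_isIntegrableMultiplier {l : ℕ} {μ : Fin l → Fin n → ℂ}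
    (hμ : ∀ i j, μ i j ≠ 0) {M : Fin l → Fin n → MvPowerSeries (Fin n) ℂ}
    (hM : IsIntegrableMultiplier μ M) {f : Fin l → FormalMap n} {Ψ : FormalMap n}
    (h : ∀ i, (f i).comp Ψ = Ψ.comp (fun j => M i j * X j)) : TransformsToNF μ f Ψ := by
  have h0 : ∀ i j, constantCoeff (M i j * X j) = 0 := by simp
  refine ⟨fun i j => M i j * X j, fun i => ⟨h0 i, ?_⟩, h, fun i =>
    (homog_iff_comp_diag (h0 i)).1 (hM.homog_mul_X i)⟩
  rw [linearPart_mul_X, Matrix.det_diagonal, isUnit_iff_ne_zero, Finset.prod_ne_zero_iff]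
  intro j _
  rw [hM.value]
  exact hμ i j

end TaylorMap

/-! ### Conclusion: convergence and identities of germs. -/

theorem theorem1p5 {n l : ℕ} (μ : Fin l → Fin n → ℂ) (hμ : ∀ i j, μ i j ≠ 0)
    (F : Fin l → (Fin n → ℂ) → (Fin n → ℂ))
    (hF : ∀ i, AnalyticAt ℂ (F i) 0)
    (hF0 : ∀ i, F i 0 = 0)
    (hFlin : ∀ i, HasFDerivAt (F i)
      (ContinuousLinearMap.pi fun j => μ i j • ContinuousLinearMap.proj j :
        (Fin n → ℂ) →L[ℂ] (Fin n → ℂ)) 0)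
    (hcomm : ∀ i k, (fun x => F i (F k x)) =ᶠ[𝓝 0] fun x => F k (F i x))
    (hint : FormallyCompletelyIntegrable μ fun i => taylorMap (F i))
    (hP : PoincareType μ) :
    ∃ Ψ : FormalMap n,
      -- `Ψ` is the unique normalized formal map that transforms the family into a normal form
      (IsNormalized μ Ψ ∧ TransformsToNF μ (fun i => taylorMap (F i)) Ψ) ∧
      (∀ Ψ' : FormalMap n, IsNormalized μ Ψ' →
        TransformsToNF μ (fun i => taylorMap (F i)) Ψ' → Ψ' = Ψ) ∧
      -- `Ψ` converges, to a germ of biholomorphism `Φ` tangent to the identity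
      ∃ (Φ : (Fin n → ℂ) → (Fin n → ℂ)) (M : Fin l → Fin n → (Fin n → ℂ) → ℂ),
        (∀ j, HasTaylor (fun x => Φ x j) (Ψ j)) ∧
        AnalyticAt ℂ Φ 0 ∧ Φ 0 = 0 ∧ HasFDerivAt Φ (ContinuousLinearMap.id ℂ (Fin n → ℂ)) 0 ∧
        -- `Φ` conjugates the family to a holomorphic completely integrable normal form
        IsHolomorphicIntegrableNF μ M ∧
        (∀ i, (fun x => F i (Φ x)) =ᶠ[𝓝 0] fun x => Φ (fun j => M i j x * x j)) ∧
        -- each member of which commutes with all the linear parts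
        (∀ i k, (fun x j => M i j (μ k * x) * (μ k * x) j) =ᶠ[𝓝 0]
          fun x => μ k * fun j => M i j x * x j) := by
  set f : Fin l → FormalMap n := fun i => taylorMap (F i) with hf
  have hfT : ∀ i j, HasTaylor (fun x => F i x j) (f i j) := fun i => hasTaylor_taylorMap (hF i)
  have hf0 : ∀ i j, MvPowerSeries.constantCoeff (f i j) = 0 := fun i j => by
    rw [← (hfT i j).apply_zero, hF0, Pi.zero_apply]
  have hflin : ∀ i, (f i).linearPart = Matrix.diagonal (μ i) := fun i =>
    linearPart_taylorMap (hF i) (hFlin i)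
  obtain ⟨Ψ, M, hΨ, hM, hconj⟩ := exists_isNormalized hμ hf0 hflin hint
  obtain ⟨ρ, K, hρ, hK⟩ := exists_truncNorm_le fun z : Fin l × Fin n => hfT z.1 z.2
  obtain ⟨r, hr, hΨr, hMr⟩ :=
    exists_truncNorm_bound hμ hP hf0 hflin hρ (fun i j => hK (i, j)) hΨ hM hconj
  have hMX0 : ∀ i j, MvPowerSeries.constantCoeff (M i j * MvPowerSeries.X j) = 0 := by simp
  refine ⟨Ψ, ⟨hΨ, transformsToNF_of_isIntegrableMultiplier hμ hM hconj⟩, ?_, ?_⟩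
  · rintro Ψ' hΨ' ⟨g, hg, hconj', hcommute⟩
    exact isNormalized_unique hf0 hflin hΨ' hΨ (fun i => (hg i).1) hMX0 hconj' hconj
      (fun i => (homog_iff_comp_diag (hg i).1).2 (hcommute i)) hM.homog_mul_X
  set Φ : (Fin n → ℂ) → Fin n → ℂ := fun x j =>
    ∑' Q : Fin n →₀ ℕ, MvPowerSeries.coeff Q (Ψ j) * multiPow x Q
  set m : Fin l → Fin n → (Fin n → ℂ) → ℂ := fun i j x =>
    ∑' Q : Fin n →₀ ℕ, MvPowerSeries.coeff Q (M i j) * multiPow x Q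
  have hΦT : ∀ j, HasTaylor (fun x => Φ x j) (Ψ j) := fun j =>
    (MvPowerSeries.AbsSummable.of_truncNorm_le hr.le fun m => hΨr m j).hasTaylor hr
  have hmT : ∀ i j, HasTaylor (m i j) (M i j) := fun i j =>
    (MvPowerSeries.AbsSummable.of_truncNorm_le hr.le fun m => hMr m i j).hasTaylor hr
  have hNF := isHolomorphicIntegrableNF_of_hasTaylor hM hmT
  refine ⟨Φ, m, hΦT, analyticAt_pi_iff.2 fun j => (hΦT j).analyticAt,
    funext fun j => ((hΦT j).apply_zero).trans (hΨ.constant j),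
    hasFDerivAt_id_of_hasTaylor hΦT hΨ.linear, hNF, fun i => ?_, fun i k => ?_⟩
  -- Both sides have the same Taylor expansion, by the formal conjugacy.
  · have h : ∀ j, (fun x => F i (Φ x) j) =ᶠ[𝓝 0] fun x => Φ (fun j => m i j x * x j) j := fun j => by
      have h1 := (hfT i j).comp hΦT hΨ.constant
      have h2 := (hΦT j).comp (fun k => hasTaylor_mul_apply (hmT i k) k) (hMX0 i)
      rw [← show (f i).comp Ψ j = MvPowerSeries.subst _ (Ψ j) from congrFun (hconj i) j] at h2
      exact h1.eventually_eq h2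
    filter_upwards [eventually_all.2 h] with x hx using funext hx
  · filter_upwards [eventually_all.2 fun j => hNF.invariant i j k] with x hx
    funext j
    rw [hx j, Pi.mul_apply, Pi.mul_apply]
    ring
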